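/- Let $R_1,R_2>0$ and let $S^2\times S^2\subset\mathbb R^3\times\mathbb R^3$, with coordinates $(x_1,y_1,z_1,x_2,y_2,z_2)$, carry the symplectic form $R_1\omega_{S^2}\oplus R_2\omega_{S^2}$, where $\omega_{S^2}$ is the standard area form. For $w,t_0,\dots,t_4\in\mathbb R$ consider the Gaudin Hamiltonian $$H_{w,\mathbf t}=t_0(z_1+z_2)^2+w(t_1z_1+t_2z_2)+t_3(x_1x_2+y_1y_2)+t_4z_1z_2$$ and the points $m_0=(0,0,1,0,0,-1)$, $m_2=(0,0,-1,0,0,1)$. Put $$t_{4,m_0}^{\pm}=\frac{w(t_1R_2-t_2R_1)\pm2t_3\sqrt{R_1R_2}}{R_1+R_2},\qquad t_{4,m_2}^{\pm}=\frac{-w(t_1R_2-t_2R_1)\pm2t_3\sqrt{R_1R_2}}{R_1+R_2}.$$ Assume the focus-focus conditions: $t_3\ne0$, and either $R_1=R_2$, $w\neq0$ and $t_1+t_2\ne0$, or $R_1\neq R_2$ and $(R_1-R_2)t_3>|w(t_1+t_2)\sqrt{R_1R_2}|$. In $\mathbb R^4$ with coordinates $(q_1,q_2,p_1,p_2)$ and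 symplectic form $dq_1\wedge dp_1+dq_2\wedge dp_2$ let $$S=q_1p_2-q_2p_1,\qquad M=\tfrac12(q_1^2+q_2^2),\qquad N=\tfrac12(p_1^2+p_2^2).$$ **Coefficients.** As functions of $R_1,R_2,w,t_0,\dots,t_4$, let $$b=-\frac{w(R_2t_1-R_1t_2)-2\sqrt{R_1R_2}\,t_3-(R_1+R_2)t_4}{2R_1R_2},\qquad \tilde a_2=-\frac{w(R_2t_1-R_1t_2)+2\sqrt{R_1R_2}\,t_3-(R_1+R_2)t_4}{2R_1R_2},$$ $$\tilde a_1=-\frac{w(R_2t_1+R_1t_2)+(R_1-R_2)t_4}{2R_1R_2},$$ and, when $b\neq0$, $$x=\frac{\tilde a_2}{b},\quad \delta=\frac{R_2-R_1}{2R_1R_2},\quad s=\frac{R_1+R_2}{2R_1R_2},\quad k=\frac{t_3}{b\sqrt{R_1R_2}},\quad D=-\frac{ks}{4},\quad E=-\frac{k\delta}{4},$$ $$A=\frac1b\Big(t_0\delta^2-\frac{t_4}{4R_1R_2}\Big),\quad B=\frac{2t_0\delta s}{b},\quad C=\frac1b\Big(t_0s^2+\frac{t_4}{4R_1R_2}\Big),$$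 $$a_1=\frac{\tilde a_1}{b},\quad a_2=x,\quad a_3=A-D+\tfrac23Ax+(A+D)x^2,\quad a_4=B-E+(B+E)x,\quad a_5=C+\tfrac13A,$$ $$a_6=\tfrac43A(A-D)+\tfrac{k\delta^2}{32}+\Big(\tfrac{152}{45}A^2-\tfrac{16}5D^2+\tfrac{k\delta^2}{160}\Big)x+\Big(\tfrac43A(A+D)-\tfrac{k\delta^2}{160}\Big)x^2-\tfrac{k\delta^2}{32}x^3,$$ $$a_7=\tfrac83AB+\tfrac43AE-2BD-2DE+\tfrac{k\delta s}{16}+\Big(\tfrac83AB-\tfrac43AE+2BD-2DE\Big)x-\tfrac{k\delta s}{16}x^2,$$ $$a_8=\tfrac4{15}A^2+B^2-\tfrac15D^2-E^2+\Big(\tfrac{k\delta^2}{160}+\tfrac{ks^2}{32}\Big)(1-x),\qquad a_9=0 .$$ Thus, for fixed $R_1,R_2$, the $a_i$ are rational functions of $w,t_0,\dots,t_4$ whose denominators are powers of $b$. Write $\widehat H=a_1S+N+a_2M+a_3M^2+a_4MS+a_5S^2+a_6M^3+a_7M^2S+a_8MS^2+a_9S^3$. **Theorem.** Fix $R_1,R_2,w,t_0,t_1,t_2,t_3$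 as above. (1) We have $t_{4,m_0}^+\ne t_{4,m_0}^-$. For every $t_4\neq t_{4,m_0}^-$ we have $b\ne0$, and there are canonical coordinates $(q,p)$ on a neighbourhood of $m_0$, centred at $m_0$ and depending smoothly on $t_4$, in which $$\frac{H_{w,\mathbf t}-H_{w,\mathbf t}(m_0)}{b}=\widehat H+O(|(q,p)|^7).$$ That is, after division by $b$ and omission of the constant term, $\widehat H$ is the normal form of $H_{w,\mathbf t}$ at $m_0$ up to sixth order in $(q,p)$ (third order in $S,M,N$). Moreover $$a_2\big|_{t_4=t_{4,m_0}^+}=0,\qquad \frac{\partial a_2}{\partial t_4}\Big|_{t_4=t_{4,m_0}^+}\neq0,$$ and $\widehat H$ is a normal form for a Hamiltonian Hopf bifurcation at $t_4=t_{4,m_0}^+$. This means that for $t_4$ near $t_{4,m_0}^+$ it equals $(\rho+\nu_1(t_4))S+\sigma N-\nu_2(t_4)M$ plus homogeneous terms of degrees four and six in $(q,p)$, where $\rho\ne0$, $\sigma=\pm1$, $\nu_1,\nu_2$ are smooth and vanish at $t_{4,m_0}^+$, $\nu_2'(t_{4,m_0}^+)\ne0$, and at $t_4=t_{4,m_0}^+$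 the terms of degrees four and six Poisson commute with $S$ and with $M$. (2) The same holds at $m_0$ with $t_{4,m_0}^+$ and $t_{4,m_0}^-$ interchanged and the roles of $M$ and $N$ interchanged, that is with $M=\frac12(p_1^2+p_2^2)$ and $N=\frac12(q_1^2+q_2^2)$, where $b$ and the $a_i$ are evaluated with $-t_3$ in place of $t_3$. (3) The same as (1) and (2) holds with $m_2$ and $t_{4,m_2}^\pm$ in place of $m_0$ and $t_{4,m_0}^\pm$, where $b$ and the $a_i$ are evaluated with $-w$ in place of $w$. -/

import Mathlib

open scoped Matrix ContDiff Topology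

noncomputable section

namespace Gaudin

/-! ### The Gaudin system on the product of two spheres -/

/-- Pairs of vectors of `ℝ³`, `v.1 = (x₁, y₁, z₁)` and `v.2 = (x₂, y₂, z₂)`. -/
abbrev Pair : Type := (Fin 3 → ℝ) × (Fin 3 → ℝ)

/-- The manifold `S² × S²`, as a subset of `ℝ³ × ℝ³`. -/
def sphereProduct : Set Pair := {v | v.1 ⬝ᵥ v.1 = 1 ∧ v.2 ⬝ᵥ v.2 = 1}

/-- The weighted symplectic form `R₁ ω_{S²} ⊕ R₂ ω_{S²}` at the point `v`, where
`ω_{S²}` at `x` is the standard area form `(a, b) ↦ ⟨x, a × b⟩`. -/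
def symplecticForm (R₁ R₂ : ℝ) (v a b : Pair) : ℝ :=
  R₁ * (v.1 ⬝ᵥ (crossProduct a.1 b.1)) + R₂ * (v.2 ⬝ᵥ (crossProduct a.2 b.2))

/-- The Hamiltonian
`t₀ (z₁ + z₂)² + w (t₁ z₁ + t₂ z₂) + t₃ (x₁ x₂ + y₁ y₂) + t₄ z₁ z₂`. -/
def hamiltonian (w t₀ t₁ t₂ t₃ t₄ : ℝ) (v : Pair) : ℝ :=
  t₀ * (v.1 2 + v.2 2) ^ 2 + w * (t₁ * v.1 2 + t₂ * v.2 2)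
    + t₃ * (v.1 0 * v.2 0 + v.1 1 * v.2 1) + t₄ * (v.1 2 * v.2 2)

/-- The rank zero point `m₀`. -/
def m₀ : Pair := (![0, 0, 1], ![0, 0, -1])

/-- The rank zero point `m₂`. -/
def m₂ : Pair := (![0, 0, -1], ![0, 0, 1])

/-- The bifurcation values `t_{4,m₀}^±` (`ε = 1` for `+`, `ε = -1` for `-`). -/
def t₄m₀ (ε R₁ R₂ w t₁ t₂ t₃ : ℝ) : ℝ :=
  (w * (t₁ * R₂ - t₂ * R₁) + ε * (2 * t₃ * √(R₁ * R₂))) / (R₁ + R₂)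

/-- The bifurcation values `t_{4,m₂}^±` (`ε = 1` for `+`, `ε = -1` for `-`). -/
def t₄m₂ (ε R₁ R₂ w t₁ t₂ t₃ : ℝ) : ℝ :=
  (-(w * (t₁ * R₂ - t₂ * R₁)) + ε * (2 * t₃ * √(R₁ * R₂))) / (R₁ + R₂)

/-- The conditions for focus-focus points. -/
def FocusFocusConditions (R₁ R₂ w t₁ t₂ t₃ : ℝ) : Prop :=
  t₃ ≠ 0 ∧
    ((R₁ = R₂ ∧ w ≠ 0 ∧ t₁ + t₂ ≠ 0) ∨
      (R₁ ≠ R₂ ∧ |w * (t₁ + t₂) * √(R₁ * R₂)| < (R₁ - R₂) * t₃))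

/-! ### The standard symplectic `ℝ⁴`, Hilbert generators and canonical coordinates -/

/-- The phase space `ℝ⁴`, with `z.1 = (q₁, q₂)` and `z.2 = (p₁, p₂)`. -/
abbrev Phase : Type := (Fin 2 → ℝ) × (Fin 2 → ℝ)

/-- The standard symplectic form `dq₁ ∧ dp₁ + dq₂ ∧ dp₂`. -/
def standardForm (a b : Phase) : ℝ := a.1 ⬝ᵥ b.2 - a.2 ⬝ᵥ b.1

/-- The generator `S = q₁ p₂ - q₂ p₁`. -/
def genS (z : Phase) : ℝ := z.1 0 * z.2 1 - z.1 1 * z.2 0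

/-- The generator `(q₁² + q₂²) / 2`. -/
def halfQ (z : Phase) : ℝ := (z.1 0 ^ 2 + z.1 1 ^ 2) / 2

/-- The generator `(p₁² + p₂²) / 2`. -/
def halfP (z : Phase) : ℝ := (z.2 0 ^ 2 + z.2 1 ^ 2) / 2

/-- The Poisson bracket `∑ i, (∂f/∂qᵢ ∂g/∂pᵢ - ∂f/∂pᵢ ∂g/∂qᵢ)`. -/
def poisson (f g : Phase → ℝ) (z : Phase) : ℝ :=
  ∑ i : Fin 2,
    (fderiv ℝ f z (Pi.single i 1, 0) * fderiv ℝ g z (0, Pi.single i 1)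
      - fderiv ℝ f z (0, Pi.single i 1) * fderiv ℝ g z (Pi.single i 1, 0))

/-- `φ` is a system of canonical coordinates near the point `m` of `S² × S²`, with domain
`V`: a smooth injective parameterisation by an open neighbourhood of `0` which sends `0` to `m`
and pulls the symplectic form back to the standard one (as the latter is nondegenerate and the
dimensions agree, `φ` is then a diffeomorphism onto an open neighbourhood of `m`). -/
structure IsCanonicalCoordinates (R₁ R₂ : ℝ) (m : Pair) (V : Set Phase) (φ : Phase → Pair) :
    Prop where
  isOpen : IsOpen V
  zero_mem : (0 : Phase) ∈ V
  map_zero : φ 0 = m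
  smooth : ContDiffOn ℝ ∞ φ V
  injective : Set.InjOn φ V
  mem_sphereProduct : ∀ z ∈ V, φ z ∈ sphereProduct
  symplectic : ∀ z ∈ V, ∀ a b : Phase,
    symplecticForm R₁ R₂ (φ z) (fderiv ℝ φ z a) (fderiv ℝ φ z b) = standardForm a b

/-- The family of functions `H t` on `S² × S²`, `t ∈ I`, has at the point `m` the family `F t`
as normal form up to sixth order in the coordinates `(q, p)`, after division by the nonzero
factor `b t`: there are canonical coordinates near `m`, depending smoothly on `t`, in which
`(H t - H t m) / b t` agrees with `F t` up to terms of order at least seven. -/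
def HasNormalForm (R₁ R₂ : ℝ) (m : Pair) (H : ℝ → Pair → ℝ) (I : Set ℝ) (b : ℝ → ℝ)
    (F : ℝ → Phase → ℝ) : Prop :=
  ∃ (U : Set (ℝ × Phase)) (Φ : ℝ × Phase → Pair),
    IsOpen U ∧ ContDiffOn ℝ ∞ Φ U ∧
    ∀ t ∈ I,
      IsCanonicalCoordinates R₁ R₂ m {z | (t, z) ∈ U} (fun z => Φ (t, z)) ∧
      b t ≠ 0 ∧
      (fun z : Phase => (H t (Φ (t, z)) - H t m) / b t - F t z)
        =O[𝓝 0] (fun z : Phase => ‖z‖ ^ 7)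

/-- The family `F t` is a normal form, up to sixth order, for a Hamiltonian Hopf bifurcation at
`t = tc`, where the generators `M` and `N` are `gM` and `gN`: near `tc` it is
`(ρ + ν₁(t)) S + σ N - ν₂(t) M` plus terms of orders four and six, with `ρ ≠ 0`, `σ = ±1`,
`ν₁(tc) = ν₂(tc) = 0` and `ν₂'(tc) ≠ 0`, and at `t = tc` the terms of orders four and six Poisson
commute with the semisimple part generator `S` and with `M`. -/
def IsHamiltonianHopfNormalForm (gM gN : Phase → ℝ) (F : ℝ → Phase → ℝ) (tc : ℝ) : Prop :=
  ∃ (l r ρ σ : ℝ) (ν₁ ν₂ : ℝ → ℝ) (G₄ G₆ : ℝ → Phase → ℝ),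
    tc ∈ Set.Ioo l r ∧
    ρ ≠ 0 ∧ (σ = 1 ∨ σ = -1) ∧
    ContDiffOn ℝ ∞ ν₁ (Set.Ioo l r) ∧ ContDiffOn ℝ ∞ ν₂ (Set.Ioo l r) ∧
    ν₁ tc = 0 ∧ ν₂ tc = 0 ∧ deriv ν₂ tc ≠ 0 ∧
    (∀ t ∈ Set.Ioo l r,
      ContDiff ℝ ∞ (G₄ t) ∧ (∀ (c : ℝ) (z : Phase), G₄ t (c • z) = c ^ 4 * G₄ t z) ∧
      ContDiff ℝ ∞ (G₆ t) ∧ (∀ (c : ℝ) (z : Phase), G₆ t (c • z) = c ^ 6 * G₆ t z) ∧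
      ∀ z, F t z = (ρ + ν₁ t) * genS z + σ * gN z - ν₂ t * gM z + G₄ t z + G₆ t z) ∧
    (∀ z, poisson genS (G₄ tc) z = 0 ∧ poisson gM (G₄ tc) z = 0 ∧
      poisson genS (G₆ tc) z = 0 ∧ poisson gM (G₆ tc) z = 0)

/-! ### The coefficients -/

/-- The nine coefficients `a₁, …, a₉` of a normal form. -/
structure Coefficients where
  a₁ : ℝ
  a₂ : ℝ
  a₃ : ℝ
  a₄ : ℝ
  a₅ : ℝ
  a₆ : ℝ
  a₇ : ℝ
  a₈ : ℝ
  a₉ : ℝ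

/-- The polynomial
`a₁S + N + a₂M + a₃M² + a₄MS + a₅S² + a₆M³ + a₇M²S + a₈MS² + a₉S³`. -/
def Coefficients.normalForm (a : Coefficients) (S M N : ℝ) : ℝ :=
  a.a₁ * S + N + a.a₂ * M
    + a.a₃ * M ^ 2 + a.a₄ * (M * S) + a.a₅ * S ^ 2
    + a.a₆ * M ^ 3 + a.a₇ * (M ^ 2 * S) + a.a₈ * (M * S ^ 2) + a.a₉ * S ^ 3

/-- The coefficient `b` of `N` before normalisation. -/
def coeffN (R₁ R₂ w t₁ t₂ t₃ t₄ : ℝ) : ℝ :=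
  -(w * (R₂ * t₁ - R₁ * t₂) - 2 * √(R₁ * R₂) * t₃ - (R₁ + R₂) * t₄) / (2 * R₁ * R₂)

/-- The coefficient of `M` before normalisation. -/
def coeffM (R₁ R₂ w t₁ t₂ t₃ t₄ : ℝ) : ℝ :=
  -(w * (R₂ * t₁ - R₁ * t₂) + 2 * √(R₁ * R₂) * t₃ - (R₁ + R₂) * t₄) / (2 * R₁ * R₂)

/-- The coefficient of `S` before normalisation. -/
def coeffS (R₁ R₂ w t₁ t₂ t₄ : ℝ) : ℝ :=
  -(w * (R₂ * t₁ + R₁ * t₂) + (R₁ - R₂) * t₄) / (2 * R₁ * R₂)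

/-- The coefficients of the normal form, normalised by the factor `coeffN`. -/
def coefficients (R₁ R₂ w t₀ t₁ t₂ t₃ t₄ : ℝ) : Coefficients :=
  let b : ℝ := coeffN R₁ R₂ w t₁ t₂ t₃ t₄
  let x : ℝ := coeffM R₁ R₂ w t₁ t₂ t₃ t₄ / b
  let δ : ℝ := (R₂ - R₁) / (2 * R₁ * R₂)
  let s : ℝ := (R₁ + R₂) / (2 * R₁ * R₂)
  let k : ℝ := t₃ / (√(R₁ * R₂) * b)
  let A : ℝ := (t₀ * δ ^ 2 - t₄ / (4 * R₁ * R₂)) / b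
  let B : ℝ := 2 * t₀ * δ * s / b
  let C : ℝ := (t₀ * s ^ 2 + t₄ / (4 * R₁ * R₂)) / b
  let D : ℝ := -(k * s) / 4
  let E : ℝ := -(k * δ) / 4
  { a₁ := coeffS R₁ R₂ w t₁ t₂ t₄ / b
    a₂ := x
    a₃ := A - D + 2 / 3 * A * x + (A + D) * x ^ 2
    a₄ := B - E + (B + E) * x
    a₅ := C + A / 3
    a₆ := 4 / 3 * A * (A - D) + k * δ ^ 2 / 32
      + (152 / 45 * A ^ 2 - 16 / 5 * D ^ 2 + k * δ ^ 2 / 160) * x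
      + (4 / 3 * A * (A + D) - k * δ ^ 2 / 160) * x ^ 2
      - k * δ ^ 2 / 32 * x ^ 3
    a₇ := 8 / 3 * A * B + 4 / 3 * A * E - 2 * B * D - 2 * D * E + k * δ * s / 16
      + (8 / 3 * A * B - 4 / 3 * A * E + 2 * B * D - 2 * D * E) * x
      - k * δ * s / 16 * x ^ 2
    a₈ := 4 / 15 * A ^ 2 + B ^ 2 - D ^ 2 / 5 - E ^ 2
      + (k * δ ^ 2 / 160 + k * s ^ 2 / 32) * (1 - x)
    a₉ := 0 }

end Gaudin

end

namespace Gaudin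

/-! Equal-area projection of each sphere, followed by a linear symplectic change of variables, gives
canonical coordinates at `m₀` in which the Hamiltonian is an exact function of S, M and N
(`hamiltonian_chart`). After subtraction of the constant and division by b it is a₁S + N + xM plus
quadratic terms in M + N and S, plus (1 - x)/2 times N - M times a product of two square roots minus
one (`hamiltonian_chart_eq_reducedHamiltonian`). All parities are even, so only the terms of degrees
four and six in (q, p) need work, and the error is of degree eight.

The normalisation takes place among polynomials in M, N, S and P = q · p, which satisfy P² + S² =
4MN. Bracketing N + xM with PM, PN, PS and with P times the quadratic monomials gives a system for
removing every monomial containing N. It is triangular, with nonzero diagonal independent of x.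
Hence it can be solved for every value of x, and what remains is a polynomial in M and S.

Flows of functions of the form P·f are not used directly. A function of |q + cp|²/2 and S has an
explicit flow, since both arguments are conserved: a rotation composed with a kick. Products of such
shears with opposite values of c generate the required odd multiples of P, and they are globally
defined, injective, symplectic and smooth in their parameters (`isSymplecticMap_prodMap`,
`contDiff_prodMap`). `hasJetState_prodMap` follows the jets of M, N, P through the product, and
`hasJet_reducedHamiltonian` checks the resulting coefficients.

The critical values are the zeros of the two affine functions `coeffN` and `coeffM`, and the
focus-focus conditions say enough to keep the S-frequency nonzero there. The other three cases
follow by symmetry: a half turn of one sphere reverses t₃ and, combined with (q, p) ↦ (-p, q),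
interchanges M and N; a simultaneous half turn of both spheres takes `m₀` to `m₂` and reverses w. -/

/-! ### Symplectic maps and rotation invariants of the phase space. -/

/-- A smooth injective symplectic map of the phase space that fixes the origin. -/
structure IsSymplecticMap (Ψ : Phase → Phase) : Prop where
  smooth : ContDiff ℝ ∞ Ψ
  injective : Function.Injective Ψ
  map_zero : Ψ 0 = 0
  symplectic : ∀ z a b : Phase,
    standardForm (fderiv ℝ Ψ z a) (fderiv ℝ Ψ z b) = standardForm a b

theorem IsSymplecticMap.id : IsSymplecticMap id where
  smooth := contDiff_id
  injective := Function.injective_id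
  map_zero := rfl
  symplectic z a b := by simp

theorem IsSymplecticMap.comp {Ψ Ψ' : Phase → Phase} (h : IsSymplecticMap Ψ)
    (h' : IsSymplecticMap Ψ') : IsSymplecticMap (Ψ ∘ Ψ') where
  smooth := h.smooth.comp h'.smooth
  injective := h.injective.comp h'.injective
  map_zero := by simp [h.map_zero, h'.map_zero]
  symplectic z a b := by
    rw [fderiv_comp z (h.smooth.differentiable (by simp) _) (h'.smooth.differentiable (by simp) _)]
    simp [h.symplectic, h'.symplectic]

/-- The third quadratic invariant `q₁ p₁ + q₂ p₂`. -/
noncomputable def dotQP (z : Phase) : ℝ := z.1 0 * z.2 0 + z.1 1 * z.2 1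

/-- Lagrange's identity in the plane. It is used to eliminate P² from the jets. -/
theorem invariants_relation (z : Phase) :
    dotQP z ^ 2 + genS z ^ 2 = 4 * halfQ z * halfP z := by
  simp only [dotQP, genS, halfQ, halfP]; ring

/-- The directional derivative as the derivative along a line. -/
theorem fderiv_apply_eq_of_hasDerivAt {E F : Type*} [NormedAddCommGroup E] [NormedSpace ℝ E]
    [NormedAddCommGroup F] [NormedSpace ℝ F] {f : E → F} {z a : E} {v : F}
    (hf : DifferentiableAt ℝ f z) (h : HasDerivAt (fun τ : ℝ => f (z + τ • a)) v 0) :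
    fderiv ℝ f z a = v :=
  hf.hasFDerivAt.hasLineDerivAt a |>.unique h

/-! ### Rotations, linear shears and twists -/

/-- The rotation of the plane by the angle `θ`. -/
noncomputable def rot (θ : ℝ) (v : Fin 2 → ℝ) : Fin 2 → ℝ :=
  ![Real.cos θ * v 0 - Real.sin θ * v 1, Real.sin θ * v 0 + Real.cos θ * v 1]

theorem rot_neg_rot (θ : ℝ) (v : Fin 2 → ℝ) : rot (-θ) (rot θ v) = v := by
  have h := Real.sin_sq_add_cos_sq θ
  ext i; fin_cases i
  · simp [rot]; linear_combination v 0 * h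
  · simp [rot]; linear_combination v 1 * h

theorem rot_injective (θ : ℝ) : Function.Injective (rot θ) :=
  Function.LeftInverse.injective (rot_neg_rot θ)

theorem rot_zero_right (θ : ℝ) : rot θ 0 = 0 := by
  ext i; fin_cases i <;> simp [rot]

theorem standardForm_rot (θ : ℝ) (a b : Phase) :
    standardForm (rot θ a.1, rot θ a.2) (rot θ b.1, rot θ b.2) = standardForm a b := by
  have h := Real.sin_sq_add_cos_sq θ
  simp [standardForm, rot, dotProduct, Fin.sum_univ_two]
  linear_combination (a.1 0 * b.2 0 + a.1 1 * b.2 1 - a.2 0 * b.1 0 - a.2 1 * b.1 1) * h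

theorem genS_rot (θ : ℝ) (z : Phase) : genS (rot θ z.1, rot θ z.2) = genS z := by
  have h := Real.sin_sq_add_cos_sq θ
  simp [genS, rot]; linear_combination (z.1 0 * z.2 1 - z.1 1 * z.2 0) * h

theorem halfQ_rot (θ : ℝ) (z : Phase) : halfQ (rot θ z.1, rot θ z.2) = halfQ z := by
  have h := Real.sin_sq_add_cos_sq θ
  simp [halfQ, rot]; linear_combination (z.1 0 ^ 2 + z.1 1 ^ 2) * h

theorem halfP_rot (θ : ℝ) (z : Phase) : halfP (rot θ z.1, rot θ z.2) = halfP z := by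
  have h := Real.sin_sq_add_cos_sq θ
  simp [halfP, rot]; linear_combination (z.2 0 ^ 2 + z.2 1 ^ 2) * h

theorem dotQP_rot (θ : ℝ) (z : Phase) : dotQP (rot θ z.1, rot θ z.2) = dotQP z := by
  have h := Real.sin_sq_add_cos_sq θ
  simp [dotQP, rot]; linear_combination (z.1 0 * z.2 0 + z.1 1 * z.2 1) * h

/-- The linear symplectic shear `(q, p) ↦ (q + c p, p)`. -/
noncomputable def tilt (c : ℝ) (z : Phase) : Phase := (z.1 + c • z.2, z.2)

theorem isSymplecticMap_tilt (c : ℝ) : IsSymplecticMap (tilt c) where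
  smooth := by unfold tilt; fun_prop
  injective := by
    intro z z' h
    simp only [tilt, Prod.mk.injEq] at h
    obtain ⟨h1, h2⟩ := h
    rw [h2] at h1
    exact Prod.ext (add_right_cancel h1) h2
  map_zero := by simp [tilt]
  symplectic z a b := by
    have h : ∀ v : Phase, fderiv ℝ (tilt c) z v = tilt c v := by
      intro v
      let l : Phase →L[ℝ] Phase :=
        (ContinuousLinearMap.fst ℝ (Fin 2 → ℝ) (Fin 2 → ℝ)
          + c • ContinuousLinearMap.snd ℝ (Fin 2 → ℝ) (Fin 2 → ℝ)).prod
          (ContinuousLinearMap.snd ℝ (Fin 2 → ℝ) (Fin 2 → ℝ))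
      have hl : tilt c = l := by
        ext z <;> simp [tilt, l]
      rw [hl, ContinuousLinearMap.fderiv]
    rw [h, h]
    simp [standardForm, tilt, dotProduct, Fin.sum_univ_two]; ring

/-! ### Nonlinear shears with explicit flows. -/

/-- The parameters of a shear in the direction `c`, generated by
`α M_c² + β M_c S + γ M_c³ + δ M_c² S + ε M_c S²` where `M_c = |q + c p|² / 2`. -/
@[ext] structure Shear where
  c : ℝ
  α : ℝ
  β : ℝ
  γ : ℝ
  δ : ℝ
  ε : ℝ

namespace Shear

/-- The derivative of the generator with respect to `M_c`. -/
noncomputable def slope (d : Shear) (m s : ℝ) : ℝ :=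
  2 * d.α * m + d.β * s + 3 * d.γ * m ^ 2 + 2 * d.δ * (m * s) + d.ε * s ^ 2

/-- The derivative of the generator with respect to `S`. -/
noncomputable def angle (d : Shear) (m s : ℝ) : ℝ := d.β * m + d.δ * m ^ 2 + 2 * d.ε * (m * s)

/-- The time one flow of the generator in the direction `c = 0`. -/
noncomputable def twist (d : Shear) (z : Phase) : Phase :=
  (rot (d.angle (halfQ z) (genS z)) z.1,
    rot (d.angle (halfQ z) (genS z)) (z.2 - d.slope (halfQ z) (genS z) • z.1))

/-- The time one flow of the generator. -/
noncomputable def map (d : Shear) (z : Phase) : Phase := tilt (-d.c) (d.twist (tilt d.c z))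

theorem genS_twist (d : Shear) (z : Phase) : genS (d.twist z) = genS z := by
  rw [twist, genS_rot _ (z.1, z.2 - d.slope (halfQ z) (genS z) • z.1)]
  simp [genS]; ring

theorem halfQ_twist (d : Shear) (z : Phase) : halfQ (d.twist z) = halfQ z := by
  rw [twist, halfQ_rot _ (z.1, z.2 - d.slope (halfQ z) (genS z) • z.1)]
  simp [halfQ]

theorem halfP_twist (d : Shear) (z : Phase) : halfP (d.twist z) =
    halfP z - d.slope (halfQ z) (genS z) * dotQP z
      + d.slope (halfQ z) (genS z) ^ 2 * halfQ z := by
  rw [twist, halfP_rot _ (z.1, z.2 - d.slope (halfQ z) (genS z) • z.1)]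
  generalize d.slope (halfQ z) (genS z) = g
  simp [halfQ, halfP, dotQP]; ring

theorem dotQP_twist (d : Shear) (z : Phase) : dotQP (d.twist z) =
    dotQP z - 2 * d.slope (halfQ z) (genS z) * halfQ z := by
  rw [twist, dotQP_rot _ (z.1, z.2 - d.slope (halfQ z) (genS z) • z.1)]
  generalize d.slope (halfQ z) (genS z) = g
  simp [halfQ, dotQP]; ring

/-- M and S are conserved, so two points with the same image share the same angle and slope; the
rotation and the kick can then be undone. -/
theorem twist_injective (d : Shear) : Function.Injective d.twist := by
  intro z z' h
  have hS : genS z = genS z' := by rw [← genS_twist d z, h, genS_twist]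
  have hQ : halfQ z = halfQ z' := by rw [← halfQ_twist d z, h, halfQ_twist]
  simp only [twist, hS, hQ, Prod.mk.injEq] at h
  have h1 := rot_injective _ h.1
  have h2 := rot_injective _ h.2
  rw [h1] at h2
  exact Prod.ext h1 (sub_left_injective h2)

theorem contDiff_twist (d : Shear) : ContDiff ℝ ∞ d.twist := by
  unfold twist rot angle slope halfQ genS
  refine ContDiff.prodMk (contDiff_pi.2 fun i => ?_) (contDiff_pi.2 fun i => ?_) <;>
    fin_cases i <;> simp <;> fun_prop

/-- The rotation is factored out of the derivative so that `standardForm_rot` can discard it. Here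
`dm`, `ds` are the differentials of M and S, and `k` is the mixed second derivative of the
generator; its occurrence in both `dg` and `dθ` is the symmetry of the Hessian, from which
symplecticity follows. -/
theorem fderiv_twist (d : Shear) (z a : Phase) :
    let m := halfQ z
    let s := genS z
    let dm := z.1 0 * a.1 0 + z.1 1 * a.1 1
    let ds := a.1 0 * z.2 1 + z.1 0 * a.2 1 - (a.1 1 * z.2 0 + z.1 1 * a.2 0)
    let k := d.β + 2 * d.δ * m + 2 * d.ε * s
    let dg := (2 * d.α + 6 * d.γ * m + 2 * d.δ * s) * dm + k * ds
    let dθ := k * dm + 2 * d.ε * m * ds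
    let g := d.slope m s
    fderiv ℝ d.twist z a =
      (rot (d.angle m s) ![a.1 0 - dθ * z.1 1, a.1 1 + dθ * z.1 0],
        rot (d.angle m s)
          ![a.2 0 - g * a.1 0 - dg * z.1 0 - dθ * (z.2 1 - g * z.1 1),
            a.2 1 - g * a.1 1 - dg * z.1 1 + dθ * (z.2 0 - g * z.1 0)]) := by
  intro m s dm ds k dg dθ g
  have hline : ∀ x y : ℝ, HasDerivAt (fun τ : ℝ => x + τ * y) y 0 := fun x y => by
    simpa using ((hasDerivAt_id (0 : ℝ)).mul_const y).const_add x
  refine fderiv_apply_eq_of_hasDerivAt (d.contDiff_twist.differentiable (by simp) z) ?_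
  have hq0 := hline (z.1 0) (a.1 0)
  have hq1 := hline (z.1 1) (a.1 1)
  have hp0 := hline (z.2 0) (a.2 0)
  have hp1 := hline (z.2 1) (a.2 1)
  have hm : HasDerivAt (fun τ : ℝ => halfQ (z + τ • a)) dm 0 := by
    convert! ((hq0.pow 2).add (hq1.pow 2)).div_const 2 using 1
    · simp [dm]; ring
  have hs : HasDerivAt (fun τ : ℝ => genS (z + τ • a)) ds 0 := by
    convert! (hq0.mul hp1).sub (hq1.mul hp0) using 1
    · simp [ds]
  have hm0 : halfQ (z + (0 : ℝ) • a) = m := by simp [m]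
  have hs0 : genS (z + (0 : ℝ) • a) = s := by simp [s]
  have hg : HasDerivAt (fun τ : ℝ => d.slope (halfQ (z + τ • a)) (genS (z + τ • a))) dg 0 := by
    convert! ((((hm.const_mul (2 * d.α)).add (hs.const_mul d.β)).add
      ((hm.pow 2).const_mul (3 * d.γ))).add ((hm.mul hs).const_mul (2 * d.δ))).add
      ((hs.pow 2).const_mul d.ε) using 1
    simp only [hm0, hs0, dg, k]; push_cast; ring
  have hθ : HasDerivAt (fun τ : ℝ => d.angle (halfQ (z + τ • a)) (genS (z + τ • a))) dθ 0 := by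
    convert! ((hm.const_mul d.β).add ((hm.pow 2).const_mul d.δ)).add
      ((hm.mul hs).const_mul (2 * d.ε)) using 1
    simp only [hm0, hs0, dθ, k]; push_cast; ring
  have hr0 := hp0.sub (hg.mul hq0)
  have hr1 := hp1.sub (hg.mul hq1)
  refine HasDerivAt.prodMk (hasDerivAt_pi.2 fun i => ?_) (hasDerivAt_pi.2 fun i => ?_) <;>
    fin_cases i
  · convert! (hθ.cos.mul hq0).sub (hθ.sin.mul hq1) using 1
    simp [rot, m, s]; ring
  · convert! (hθ.sin.mul hq0).add (hθ.cos.mul hq1) using 1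
    simp [rot, m, s]; ring
  · convert! (hθ.cos.mul hr0).sub (hθ.sin.mul hr1) using 1
    simp [rot, m, s, g]; ring
  · convert! (hθ.sin.mul hr0).add (hθ.cos.mul hr1) using 1
    simp [rot, m, s, g]; ring

theorem isSymplecticMap_twist (d : Shear) : IsSymplecticMap d.twist where
  smooth := d.contDiff_twist
  injective := d.twist_injective
  map_zero := by simp [twist, rot_zero_right]
  symplectic z a b := by
    rw [fderiv_twist, fderiv_twist]
    rw [standardForm_rot _ (_, _) (_, _)]
    generalize d.slope (halfQ z) (genS z) = g
    simp [standardForm, dotProduct, Fin.sum_univ_two]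
    ring

theorem isSymplecticMap_map (d : Shear) : IsSymplecticMap d.map :=
  ((isSymplecticMap_tilt _).comp d.isSymplecticMap_twist).comp (isSymplecticMap_tilt _)

end Shear

theorem genS_tilt (c : ℝ) (z : Phase) : genS (tilt c z) = genS z := by
  simp [tilt, genS]; ring

theorem halfQ_tilt (c : ℝ) (z : Phase) :
    halfQ (tilt c z) = halfQ z + c * dotQP z + c ^ 2 * halfP z := by
  simp [tilt, halfQ, halfP, dotQP]; ring

theorem halfP_tilt (c : ℝ) (z : Phase) : halfP (tilt c z) = halfP z := by
  simp [tilt, halfP]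

theorem dotQP_tilt (c : ℝ) (z : Phase) : dotQP (tilt c z) = dotQP z + 2 * c * halfP z := by
  simp [tilt, dotQP, halfP]; ring

namespace Shear

/-- The slope of the shear at a point, in terms of the invariants. -/
noncomputable def slopeAt (d : Shear) (z : Phase) : ℝ :=
  d.slope (halfQ z + d.c * dotQP z + d.c ^ 2 * halfP z) (genS z)

theorem genS_map (d : Shear) (z : Phase) : genS (d.map z) = genS z := by
  simp [map, genS_tilt, genS_twist]

/-- Rotations do not affect the invariants, so the angle disappears and only the slope, evaluated at
M_c and S, enters. The invariants therefore transform among themselves. -/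
theorem halfQ_map (d : Shear) (z : Phase) : halfQ (d.map z) =
    halfQ z + d.c * (d.slopeAt z * (2 * halfQ z + d.c * dotQP z))
      + d.c ^ 2 * (d.slopeAt z ^ 2 * (halfQ z + d.c * dotQP z + d.c ^ 2 * halfP z)) := by
  simp only [map, halfQ_tilt, halfQ_twist, dotQP_twist, halfP_twist, dotQP_tilt, halfP_tilt,
    genS_tilt, slopeAt]
  ring

theorem halfP_map (d : Shear) (z : Phase) : halfP (d.map z) =
    halfP z - d.slopeAt z * (dotQP z + 2 * d.c * halfP z)
      + d.slopeAt z ^ 2 * (halfQ z + d.c * dotQP z + d.c ^ 2 * halfP z) := by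
  simp only [map, halfQ_tilt, halfP_twist, dotQP_tilt, halfP_tilt, genS_tilt, slopeAt]

theorem dotQP_map (d : Shear) (z : Phase) : dotQP (d.map z) =
    dotQP z - 2 * (d.slopeAt z * (halfQ z - d.c ^ 2 * halfP z))
      - 2 * d.c * (d.slopeAt z ^ 2 * (halfQ z + d.c * dotQP z + d.c ^ 2 * halfP z)) := by
  simp only [map, halfQ_tilt, halfP_twist, dotQP_twist, dotQP_tilt, halfP_tilt, genS_tilt, slopeAt]
  ring

end Shear

/-! ### Smooth families of products of shears -/

namespace Shear

variable {E : Type*} [NormedAddCommGroup E] [NormedSpace ℝ E]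

/-- The parameters of the shear `d v` depend smoothly on `v`. -/
structure Smooth (d : E → Shear) : Prop where
  c : ContDiff ℝ ∞ (fun v => (d v).c)
  α : ContDiff ℝ ∞ (fun v => (d v).α)
  β : ContDiff ℝ ∞ (fun v => (d v).β)
  γ : ContDiff ℝ ∞ (fun v => (d v).γ)
  δ : ContDiff ℝ ∞ (fun v => (d v).δ)
  ε : ContDiff ℝ ∞ (fun v => (d v).ε)

/-- The shear with the given vector of parameters. -/
def ofVec (v : Fin 6 → ℝ) : Shear := ⟨v 0, v 1, v 2, v 3, v 4, v 5⟩

theorem contDiff_ofVec_map :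
    ContDiff ℝ ∞ (fun y : (Fin 6 → ℝ) × Phase => (ofVec y.1).map y.2) := by
  unfold map twist tilt rot angle slope halfQ genS ofVec
  simp only [Pi.add_apply, Pi.smul_apply, Pi.sub_apply, smul_eq_mul]
  refine ContDiff.prodMk (contDiff_pi.2 fun i => ?_) (contDiff_pi.2 fun i => ?_) <;>
    fin_cases i <;> simp <;> fun_prop

theorem Smooth.contDiff_map {d : E → Shear} (hd : Smooth d) {Ψ : E × Phase → Phase}
    (hΨ : ContDiff ℝ ∞ Ψ) : ContDiff ℝ ∞ (fun y => (d y.1).map (Ψ y)) := by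
  have hv : ContDiff ℝ ∞
      (fun v => ![(d v).c, (d v).α, (d v).β, (d v).γ, (d v).δ, (d v).ε]) := by
    refine contDiff_pi.2 fun i => ?_
    fin_cases i
    exacts [hd.c, hd.α, hd.β, hd.γ, hd.δ, hd.ε]
  have hd' : ∀ v, d v = ofVec ![(d v).c, (d v).α, (d v).β, (d v).γ, (d v).δ, (d v).ε] :=
    fun v => Shear.ext rfl rfl rfl rfl rfl rfl
  have h2 := contDiff_ofVec_map.comp ((hv.comp (contDiff_fst (F := Phase))).prodMk hΨ)
  have h3 : (fun y => (d y.1).map (Ψ y)) = fun y : E × Phase =>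
      (ofVec ![(d y.1).c, (d y.1).α, (d y.1).β, (d y.1).γ, (d y.1).δ, (d y.1).ε]).map (Ψ y) :=
    funext fun y => congrArg (fun e : Shear => e.map (Ψ y)) (hd' y.1)
  rw [h3]
  exact h2

/-- The composition of a list of shears. -/
noncomputable def prodMap : List Shear → Phase → Phase
  | [] => id
  | d :: L => d.map ∘ prodMap L

theorem isSymplecticMap_prodMap (L : List Shear) : IsSymplecticMap (prodMap L) := by
  induction L with
  | nil => exact IsSymplecticMap.id
  | cons d L ih => exact d.isSymplecticMap_map.comp ih

theorem contDiff_prodMap (L : List (E → Shear)) (hL : ∀ d ∈ L, Smooth d) :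
    ContDiff ℝ ∞ (fun y : E × Phase => prodMap (L.map fun d => d y.1) y.2) := by
  induction L with
  | nil => exact contDiff_snd
  | cons d L ih =>
    exact (hL d (by simp)).contDiff_map (ih fun e he => hL e (by simp [he]))

end Shear

/-! ### Orders of vanishing and jets -/

/-- The function `f` vanishes at the origin to order at least `n`. -/
def VanishesTo (n : ℕ) (f : Phase → ℝ) : Prop := f =O[𝓝 0] (fun z : Phase => ‖z‖ ^ n)

namespace VanishesTo

variable {m n : ℕ} {f g : Phase → ℝ}

theorem add (hf : VanishesTo n f) (hg : VanishesTo n g) : VanishesTo n (fun z => f z + g z) :=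
  Asymptotics.IsBigO.add hf hg

theorem sub (hf : VanishesTo n f) (hg : VanishesTo n g) : VanishesTo n (fun z => f z - g z) :=
  Asymptotics.IsBigO.sub hf hg

theorem const_mul (c : ℝ) (hf : VanishesTo n f) : VanishesTo n (fun z => c * f z) :=
  Asymptotics.IsBigO.const_mul_left hf c

theorem mul (hf : VanishesTo m f) (hg : VanishesTo n g) :
    VanishesTo (m + n) (fun z => f z * g z) := by
  have h := Asymptotics.IsBigO.mul hf hg
  simp only [← pow_add] at h
  exact h

theorem mono (hf : VanishesTo n f) (hmn : m ≤ n) : VanishesTo m f := by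
  refine hf.trans (Asymptotics.IsBigO.of_bound 1 ?_)
  filter_upwards [Metric.closedBall_mem_nhds (0 : Phase) one_pos] with z hz
  rw [mem_closedBall_zero_iff] at hz
  simpa using pow_le_pow_of_le_one (norm_nonneg z) hz hmn

theorem zero : VanishesTo n (fun _ => 0) := Asymptotics.isBigO_zero _ _

end VanishesTo

theorem vanishesTo_coord_fst (i : Fin 2) : VanishesTo 1 (fun z => z.1 i) := by
  refine Asymptotics.IsBigO.of_bound 1 (Filter.Eventually.of_forall fun z => ?_)
  simpa using (norm_le_pi_norm z.1 i).trans (norm_fst_le z)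

theorem vanishesTo_coord_snd (i : Fin 2) : VanishesTo 1 (fun z => z.2 i) := by
  refine Asymptotics.IsBigO.of_bound 1 (Filter.Eventually.of_forall fun z => ?_)
  simpa using (norm_le_pi_norm z.2 i).trans (norm_snd_le z)

theorem vanishesTo_halfQ : VanishesTo 2 halfQ := by
  have h := fun i => (vanishesTo_coord_fst i).mul (vanishesTo_coord_fst i)
  convert ((h 0).add (h 1)).const_mul (1 / 2) using 2
  simp only [halfQ]; ring

theorem vanishesTo_halfP : VanishesTo 2 halfP := by
  have h := fun i => (vanishesTo_coord_snd i).mul (vanishesTo_coord_snd i)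
  convert ((h 0).add (h 1)).const_mul (1 / 2) using 2
  simp only [halfP]; ring

theorem vanishesTo_dotQP : VanishesTo 2 dotQP :=
  ((vanishesTo_coord_fst 0).mul (vanishesTo_coord_snd 0)).add
    ((vanishesTo_coord_fst 1).mul (vanishesTo_coord_snd 1))

theorem vanishesTo_genS : VanishesTo 2 genS :=
  ((vanishesTo_coord_fst 0).mul (vanishesTo_coord_snd 1)).sub
    ((vanishesTo_coord_fst 1).mul (vanishesTo_coord_snd 0))

/-- The function `f` agrees with `f₁ + f₂ + f₃` up to terms of order at least eight, where `fᵢ`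
vanishes to order `2 i`. -/
structure HasJet (f f₁ f₂ f₃ : Phase → ℝ) : Prop where
  one : VanishesTo 2 f₁
  two : VanishesTo 4 f₂
  three : VanishesTo 6 f₃
  error : VanishesTo 8 (fun z => f z - (f₁ z + f₂ z + f₃ z))

namespace HasJet

variable {f g f₁ f₂ f₃ g₁ g₂ g₃ : Phase → ℝ}

theorem of_vanishesTo_two (hf : VanishesTo 2 f) : HasJet f f (fun _ => 0) (fun _ => 0) where
  one := hf
  two := .zero
  three := .zero
  error := by simpa using VanishesTo.zero

theorem vanishesTo_sum (hf : HasJet f f₁ f₂ f₃) :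
    VanishesTo 2 (fun z => f₁ z + f₂ z + f₃ z) :=
  (hf.one.add (hf.two.mono (by norm_num))).add (hf.three.mono (by norm_num))

theorem vanishesTo (hf : HasJet f f₁ f₂ f₃) : VanishesTo 2 f := by
  simpa using (hf.error.mono (by norm_num)).add hf.vanishesTo_sum

theorem congr' (hf : HasJet f f₁ f₂ f₃) (h : ∀ z, g z = f z) (h₁ : ∀ z, g₁ z = f₁ z)
    (h₂ : ∀ z, g₂ z = f₂ z) (h₃ : ∀ z, g₃ z = f₃ z) : HasJet g g₁ g₂ g₃ := by
  rwa [funext h, funext h₁, funext h₂, funext h₃]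

theorem add (hf : HasJet f f₁ f₂ f₃) (hg : HasJet g g₁ g₂ g₃) :
    HasJet (fun z => f z + g z) (fun z => f₁ z + g₁ z) (fun z => f₂ z + g₂ z)
      (fun z => f₃ z + g₃ z) where
  one := hf.one.add hg.one
  two := hf.two.add hg.two
  three := hf.three.add hg.three
  error := by
    convert hf.error.add hg.error using 2
    ring

theorem const_mul (c : ℝ) (hf : HasJet f f₁ f₂ f₃) :
    HasJet (fun z => c * f z) (fun z => c * f₁ z) (fun z => c * f₂ z) (fun z => c * f₃ z) where
  one := hf.one.const_mul c
  two := hf.two.const_mul c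
  three := hf.three.const_mul c
  error := by
    convert hf.error.const_mul c using 2
    ring

theorem mul (hf : HasJet f f₁ f₂ f₃) (hg : HasJet g g₁ g₂ g₃) :
    HasJet (fun z => f z * g z) (fun _ => 0) (fun z => f₁ z * g₁ z)
      (fun z => f₁ z * g₂ z + f₂ z * g₁ z) where
  one := .zero
  two := hf.one.mul hg.one
  three := (hf.one.mul hg.two).add (hf.two.mul hg.one)
  error := by
    -- With F and G the truncated sums, the remainder is (f - F)g + F(g - G) + f₁g₃ + f₂(g₂ + g₃) +
    -- f₃G; each summand has order at least eight.
    have e1 := (hf.error.mul hg.vanishesTo).mono (show 8 ≤ 8 + 2 by norm_num)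
    have e2 := (hf.vanishesTo_sum.mul hg.error).mono (show 8 ≤ 2 + 8 by norm_num)
    have e3 := hf.one.mul hg.three
    have e4 := hf.two.mul (hg.two.add (hg.three.mono (by norm_num)))
    have e5 := (hf.three.mul hg.vanishesTo_sum)
    convert (((e1.add e2).add e3).add e4).add e5 using 2
    ring

end HasJet

/-! ### Transport of the jets of the invariants through shears. -/

/-- The terms of orders four and six of the jets of `M`, `N` and `P = q · p` after a change of
coordinates. -/
@[ext] structure JetState where
  m₂ : ℝ
  n₂ : ℝ
  p₂ : ℝ
  m₃ : ℝ
  n₃ : ℝ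
  p₃ : ℝ

/-- The effect of a shear on the jets of the invariants, where `m, n, p, s` are the values of
`M`, `N`, `P` and `S`. -/
def JetState.step (d : Shear) (m n p s : ℝ) (σ : JetState) : JetState :=
  let u := m + d.c * p + d.c ^ 2 * n
  -- The parts of the slope of degrees two and four; `g₂` includes the correction to M_c already
  -- accumulated in the state.
  let g₁ := 2 * d.α * u + d.β * s
  let g₂ := 2 * d.α * (σ.m₂ + d.c * σ.p₂ + d.c ^ 2 * σ.n₂)
    + 3 * d.γ * u ^ 2 + 2 * d.δ * (u * s) + d.ε * s ^ 2
  { m₂ := σ.m₂ + d.c * (g₁ * (2 * m + d.c * p))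
    n₂ := σ.n₂ - g₁ * (p + 2 * d.c * n)
    p₂ := σ.p₂ - 2 * (g₁ * (m - d.c ^ 2 * n))
    m₃ := σ.m₃ + d.c * (g₁ * (2 * σ.m₂ + d.c * σ.p₂) + g₂ * (2 * m + d.c * p))
      + d.c ^ 2 * (g₁ ^ 2 * u)
    n₃ := σ.n₃ - (g₁ * (σ.p₂ + 2 * d.c * σ.n₂) + g₂ * (p + 2 * d.c * n)) + g₁ ^ 2 * u
    p₃ := σ.p₃ - 2 * (g₁ * (σ.m₂ - d.c ^ 2 * σ.n₂) + g₂ * (m - d.c ^ 2 * n))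
      - 2 * d.c * (g₁ ^ 2 * u) }

/-- The jets of the invariants after a product of shears. -/
def jetState (m n p s : ℝ) : List Shear → JetState
  | [] => ⟨0, 0, 0, 0, 0, 0⟩
  | d :: L => (jetState m n p s L).step d m n p s

/-- The jets of the invariants after the change of coordinates `Ψ` are given by `σ`. -/
structure HasJetState (Ψ : Phase → Phase) (σ : Phase → JetState) : Prop where
  genS : ∀ z, genS (Ψ z) = genS z
  halfQ : HasJet (fun z => halfQ (Ψ z)) halfQ (fun z => (σ z).m₂) (fun z => (σ z).m₃)
  halfP : HasJet (fun z => halfP (Ψ z)) halfP (fun z => (σ z).n₂) (fun z => (σ z).n₃)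
  dotQP : HasJet (fun z => dotQP (Ψ z)) dotQP (fun z => (σ z).p₂) (fun z => (σ z).p₃)

/-- The exact formulas for M, N, P under a shear are polynomials, so jets can be added and
multiplied through them. S has no corrections because it is conserved exactly. -/
theorem HasJetState.step {Ψ : Phase → Phase} {σ : Phase → JetState} (h : HasJetState Ψ σ)
    (d : Shear) : HasJetState (d.map ∘ Ψ)
      (fun z => (σ z).step d (Gaudin.halfQ z) (Gaudin.halfP z) (Gaudin.dotQP z)
        (Gaudin.genS z)) := by
  have hS : HasJet (fun z => Gaudin.genS (Ψ z)) Gaudin.genS (fun _ => 0) (fun _ => 0) := by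
    rw [funext h.genS]; exact HasJet.of_vanishesTo_two vanishesTo_genS
  have hu := (h.halfQ.add (h.dotQP.const_mul d.c)).add (h.halfP.const_mul (d.c ^ 2))
  have hg := ((((hu.const_mul (2 * d.α)).add (hS.const_mul d.β)).add
    ((hu.mul hu).const_mul (3 * d.γ))).add ((hu.mul hS).const_mul (2 * d.δ))).add
    ((hS.mul hS).const_mul d.ε)
  have hgu := (hg.mul hg).mul hu
  have hv := (h.halfQ.const_mul 2).add (h.dotQP.const_mul d.c)
  have hw := h.dotQP.add (h.halfP.const_mul (2 * d.c))
  have hy := h.halfQ.add (h.halfP.const_mul (-d.c ^ 2))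
  refine ⟨fun z => by simp [Shear.genS_map, h.genS], ?_, ?_, ?_⟩
  · refine ((h.halfQ.add ((hg.mul hv).const_mul d.c)).add (hgu.const_mul (d.c ^ 2))).congr'
      (fun z => ?_) (fun z => ?_) (fun z => ?_) (fun z => ?_)
    · simp only [Function.comp_apply, Shear.halfQ_map, Shear.slopeAt, Shear.slope]; ring
    · ring
    · simp only [JetState.step]; ring
    · simp only [JetState.step]; ring
  · refine ((h.halfP.add ((hg.mul hw).const_mul (-1))).add hgu).congr'
      (fun z => ?_) (fun z => ?_) (fun z => ?_) (fun z => ?_)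
    · simp only [Function.comp_apply, Shear.halfP_map, Shear.slopeAt, Shear.slope]; ring
    · ring
    · simp only [JetState.step]; ring
    · simp only [JetState.step]; ring
  · refine ((h.dotQP.add ((hg.mul hy).const_mul (-2))).add (hgu.const_mul (-2 * d.c))).congr'
      (fun z => ?_) (fun z => ?_) (fun z => ?_) (fun z => ?_)
    · simp only [Function.comp_apply, Shear.dotQP_map, Shear.slopeAt, Shear.slope]; ring
    · ring
    · simp only [JetState.step]; ring
    · simp only [JetState.step]; ring

theorem hasJetState_prodMap (L : List Shear) :
    HasJetState (Shear.prodMap L)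
      (fun z => jetState (halfQ z) (halfP z) (dotQP z) (genS z) L) := by
  induction L with
  | nil =>
    exact ⟨fun _ => rfl, HasJet.of_vanishesTo_two vanishesTo_halfQ,
      HasJet.of_vanishesTo_two vanishesTo_halfP, HasJet.of_vanishesTo_two vanishesTo_dotQP⟩
  | cons d L ih => exact ih.step d

/-! ### Canonical coordinates near `m₀` -/

/-- Composing canonical coordinates with a symplectic map. -/
theorem IsCanonicalCoordinates.comp {R₁ R₂ : ℝ} {m : Pair} {V : Set Phase} {φ : Phase → Pair}
    (hφ : IsCanonicalCoordinates R₁ R₂ m V φ) {Ψ : Phase → Phase} (hΨ : IsSymplecticMap Ψ) :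
    IsCanonicalCoordinates R₁ R₂ m (Ψ ⁻¹' V) (fun z => φ (Ψ z)) where
  isOpen := hφ.isOpen.preimage hΨ.smooth.continuous
  zero_mem := by simpa [hΨ.map_zero] using hφ.zero_mem
  map_zero := by rw [hΨ.map_zero, hφ.map_zero]
  smooth := hφ.smooth.comp hΨ.smooth.contDiffOn fun _ h => h
  injective := fun z hz z' hz' h => hΨ.injective (hφ.injective hz hz' h)
  mem_sphereProduct := fun z hz => hφ.mem_sphereProduct _ hz
  symplectic z hz a b := by
    have hd : DifferentiableAt ℝ φ (Ψ z) :=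
      (hφ.smooth.contDiffAt (hφ.isOpen.mem_nhds hz)).differentiableAt (by simp)
    have hc : fderiv ℝ (fun z => φ (Ψ z)) z = (fderiv ℝ φ (Ψ z)).comp (fderiv ℝ Ψ z) :=
      fderiv_comp z hd (hΨ.smooth.differentiable (by simp) z)
    rw [hc]
    simp only [ContinuousLinearMap.comp_apply]
    rw [hφ.symplectic _ hz, hΨ.symplectic]

/-! ### The equal-area chart of the sphere. -/

/-- The conformal factor of the equal area projection of the sphere. -/
noncomputable def polarFactor (R u v : ℝ) : ℝ := √(1 - (u ^ 2 + v ^ 2) / (4 * R))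

/-- The inverse of the equal area projection of the sphere with area form `R ω` from the north
pole. -/
noncomputable def polar (R u v : ℝ) : Fin 3 → ℝ :=
  ![u * polarFactor R u v / √R, v * polarFactor R u v / √R, 1 - (u ^ 2 + v ^ 2) / (2 * R)]

section Polar

variable {R u v : ℝ}

theorem polarFactor_arg_pos (hR : 0 < R) (h : u ^ 2 + v ^ 2 < 4 * R) :
    0 < 1 - (u ^ 2 + v ^ 2) / (4 * R) := by
  rw [sub_pos, div_lt_one (by positivity)]; exact h

theorem polarFactor_sq (hR : 0 < R) (h : u ^ 2 + v ^ 2 < 4 * R) :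
    polarFactor R u v ^ 2 = 1 - (u ^ 2 + v ^ 2) / (4 * R) :=
  Real.sq_sqrt (polarFactor_arg_pos hR h).le

theorem polarFactor_pos (hR : 0 < R) (h : u ^ 2 + v ^ 2 < 4 * R) : 0 < polarFactor R u v :=
  Real.sqrt_pos.2 (polarFactor_arg_pos hR h)

theorem polar_dotProduct_self (hR : 0 < R) (h : u ^ 2 + v ^ 2 < 4 * R) :
    polar R u v ⬝ᵥ polar R u v = 1 := by
  have h1 := polarFactor_sq hR h
  have h2 := Real.sq_sqrt hR.le
  have h3 : √R ≠ 0 := (Real.sqrt_pos.2 hR).ne'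
  simp only [polar, dotProduct, Fin.sum_univ_three, Matrix.cons_val]
  generalize polarFactor R u v = κ at *
  generalize √R = r at *
  subst h2
  field_simp at h1 ⊢
  linear_combination (u ^ 2 + v ^ 2) * h1

/-- The height determines u² + v², hence the radial factor, which is positive and can be cancelled.
-/
theorem polar_injective (hR : 0 < R) {u' v' : ℝ} (h : u ^ 2 + v ^ 2 < 4 * R)
    (he : polar R u v = polar R u' v') : u = u' ∧ v = v' := by
  have h0 : u ^ 2 + v ^ 2 = u' ^ 2 + v' ^ 2 := by
    have := congrFun he 2
    simp only [polar, Matrix.cons_val] at this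
    field_simp at this
    linarith
  have h1 : polarFactor R u' v' = polarFactor R u v := by simp only [polarFactor, h0]
  have h3 : √R ≠ 0 := (Real.sqrt_pos.2 hR).ne'
  have h4 := (polarFactor_pos hR h).ne'
  have e0 := congrFun he 0
  have e1 := congrFun he 1
  simp only [polar, h1, Matrix.cons_val] at e0 e1
  field_simp at e0 e1
  exact ⟨e0, e1⟩

theorem contDiffOn_polar (hR : 0 < R) {E : Type*} [NormedAddCommGroup E] [NormedSpace ℝ E]
    {f g : E → ℝ} (hf : ContDiff ℝ ∞ f) (hg : ContDiff ℝ ∞ g) :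
    ContDiffOn ℝ ∞ (fun z => polar R (f z) (g z)) {z | f z ^ 2 + g z ^ 2 < 4 * R} := by
  have h1 : ContDiffOn ℝ ∞ (fun z => polarFactor R (f z) (g z))
      {z | f z ^ 2 + g z ^ 2 < 4 * R} :=
    ContDiffOn.sqrt (ContDiff.contDiffOn (by fun_prop))
      fun z hz => (polarFactor_arg_pos hR hz).ne'
  refine contDiffOn_pi.2 fun i => ?_
  fin_cases i
  · exact (hf.contDiffOn.mul h1).div_const _
  · exact (hg.contDiffOn.mul h1).div_const _
  · have h2 : ContDiff ℝ ∞ (fun z => 1 - (f z ^ 2 + g z ^ 2) / (2 * R)) := by fun_prop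
    exact h2.contDiffOn

/-- The derivative of `polar` in the direction `(a, b)`. -/
noncomputable def polarDeriv (R u v a b : ℝ) : Fin 3 → ℝ :=
  let κ := polarFactor R u v
  let κ' := -(u * a + v * b) / (4 * R * κ)
  ![(a * κ + u * κ') / √R, (b * κ + v * κ') / √R, -(u * a + v * b) / R]

theorem hasDerivAt_polar (hR : 0 < R) {f g : ℝ → ℝ} {a b τ : ℝ}
    (h : f τ ^ 2 + g τ ^ 2 < 4 * R) (hf : HasDerivAt f a τ) (hg : HasDerivAt g b τ) :
    HasDerivAt (fun τ => polar R (f τ) (g τ)) (polarDeriv R (f τ) (g τ) a b) τ := by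
  have hI := (hf.pow 2).add (hg.pow 2)
  have hκ : HasDerivAt (fun τ => polarFactor R (f τ) (g τ))
      (-(f τ * a + g τ * b) / (4 * R * polarFactor R (f τ) (g τ))) τ := by
    convert! ((hI.div_const (4 * R)).const_sub 1).sqrt (polarFactor_arg_pos hR h).ne' using 1
    have h4 := (polarFactor_pos hR h).ne'
    simp only [polarFactor] at h4 ⊢
    simp only [Pi.add_apply, Pi.pow_apply]
    field_simp
    push_cast
    ring
  refine hasDerivAt_pi.2 fun i => ?_
  fin_cases i
  · exact (hf.mul hκ).div_const _
  · exact (hg.mul hκ).div_const _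
  · convert! (hI.div_const (2 * R)).const_sub 1 using 1
    simp [polarDeriv]
    field_simp
    ring

/-- Archimedes' theorem: area on the sphere is height times angle, and R times the drop in height
from the pole is (u² + v²)/2, the action of the planar area form. -/
theorem polar_areaForm (hR : 0 < R) (h : u ^ 2 + v ^ 2 < 4 * R) (a b a' b' : ℝ) :
    R * (polar R u v ⬝ᵥ crossProduct (polarDeriv R u v a b) (polarDeriv R u v a' b'))
      = a * b' - b * a' := by
  have h1 := polarFactor_sq hR h
  have h2 := Real.sq_sqrt hR.le
  have h3 : √R ≠ 0 := (Real.sqrt_pos.2 hR).ne'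
  have h4 := (polarFactor_pos hR h).ne'
  simp only [polar, polarDeriv, crossProduct, dotProduct, Fin.sum_univ_three, Matrix.cons_val,
    LinearMap.mk₂_apply]
  generalize polarFactor R u v = κ at *
  generalize √R = r at *
  subst h2
  -- The square root relation is solved for u², so that the claim becomes a polynomial identity in
  -- the remaining variables.
  have h5 : u ^ 2 = 4 * r ^ 2 * (1 - κ ^ 2) - v ^ 2 := by
    field_simp at h1
    linarith
  field_simp
  ring_nf
  simp only [show u ^ 4 = u ^ 2 * u ^ 2 by ring, h5]
  ring

end Polar

/-- The rotation of the sphere which exchanges the poles and fixes the second axis. -/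
def flip (x : Fin 3 → ℝ) : Fin 3 → ℝ := ![-x 0, x 1, -x 2]

theorem flip_dotProduct_self (x : Fin 3 → ℝ) : flip x ⬝ᵥ flip x = x ⬝ᵥ x := by
  simp [flip, dotProduct, Fin.sum_univ_three]

theorem flip_areaForm (x a b : Fin 3 → ℝ) :
    flip x ⬝ᵥ crossProduct (flip a) (flip b) = x ⬝ᵥ crossProduct a b := by
  simp [flip, dotProduct, Fin.sum_univ_three, crossProduct]; ring

theorem flip_injective : Function.Injective flip := by
  intro x y h
  have h0 := congrFun h 0
  have h1 := congrFun h 1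
  have h2 := congrFun h 2
  simp only [flip, Matrix.cons_val, neg_inj] at h0 h1 h2
  ext i; fin_cases i <;> assumption

theorem contDiff_flip : ContDiff ℝ ∞ flip := by
  refine contDiff_pi.2 fun i => ?_
  fin_cases i <;> simp [flip] <;> fun_prop

theorem hasDerivAt_flip {f : ℝ → Fin 3 → ℝ} {f' : Fin 3 → ℝ} {τ : ℝ} (h : HasDerivAt f f' τ) :
    HasDerivAt (fun τ => flip (f τ)) (flip f') τ := by
  rw [hasDerivAt_pi] at h
  refine hasDerivAt_pi.2 fun i => ?_
  fin_cases i
  exacts [(h 0).neg, h 1, (h 2).neg]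

/-- Canonical coordinates near `m₀` which diagonalise the quadratic part of the Hamiltonian. -/
noncomputable def chart (R₁ R₂ : ℝ) (z : Phase) : Pair :=
  (polar R₁ ((z.1 0 + z.2 1) / √2) ((z.2 0 - z.1 1) / √2),
    flip (polar R₂ ((z.1 0 - z.2 1) / √2) ((z.2 0 + z.1 1) / √2)))

/-- The domain of `chart`. -/
def chartDomain (R₁ R₂ : ℝ) : Set Phase :=
  {z | ((z.1 0 + z.2 1) / √2) ^ 2 + ((z.2 0 - z.1 1) / √2) ^ 2 < 4 * R₁} ∩
    {z | ((z.1 0 - z.2 1) / √2) ^ 2 + ((z.2 0 + z.1 1) / √2) ^ 2 < 4 * R₂}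

/-- The linear mixing is symplectic, and `flip`, being a rotation, moves the chart of the second
sphere to the south pole without changing the area form. The squared radii in the two planes become
M + N + S and M + N - S. -/
theorem isCanonicalCoordinates_chart {R₁ R₂ : ℝ} (hR₁ : 0 < R₁) (hR₂ : 0 < R₂) :
    IsCanonicalCoordinates R₁ R₂ m₀ (chartDomain R₁ R₂) (chart R₁ R₂) := by
  have hopen : IsOpen (chartDomain R₁ R₂) :=
    (isOpen_lt (by fun_prop) (by fun_prop)).inter (isOpen_lt (by fun_prop) (by fun_prop))
  have hsq : √2 ^ 2 = (2 : ℝ) := Real.sq_sqrt zero_le_two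
  have hsq0 : √2 ≠ (0 : ℝ) := by positivity
  have hsmooth : ContDiffOn ℝ ∞ (chart R₁ R₂) (chartDomain R₁ R₂) := by
    refine ContDiffOn.prodMk ?_ (contDiff_flip.comp_contDiffOn ?_)
    · exact (contDiffOn_polar hR₁ (by fun_prop) (by fun_prop)).mono Set.inter_subset_left
    · exact (contDiffOn_polar hR₂ (by fun_prop) (by fun_prop)).mono Set.inter_subset_right
  refine ⟨hopen, by simp [chartDomain, hR₁, hR₂], ?_, hsmooth, ?_, ?_, ?_⟩
  · refine Prod.ext ?_ ?_ <;> ext i <;> fin_cases i <;> simp [chart, polar, flip, m₀]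
  · rintro z ⟨h1, h2⟩ z' - h
    obtain ⟨e1, e2⟩ := polar_injective hR₁ h1 (congrArg Prod.fst h)
    obtain ⟨e3, e4⟩ := polar_injective hR₂ h2 (flip_injective (congrArg Prod.snd h))
    field_simp at e1 e2 e3 e4
    refine Prod.ext ?_ ?_ <;> ext i <;> fin_cases i <;> simp <;> linarith
  · rintro z ⟨h1, h2⟩
    exact ⟨polar_dotProduct_self hR₁ h1,
      (flip_dotProduct_self _).trans (polar_dotProduct_self hR₂ h2)⟩
  · intro z hz a b
    have hline : ∀ x y : ℝ, HasDerivAt (fun τ : ℝ => x + τ * y) y 0 := fun x y => by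
      simpa using ((hasDerivAt_id (0 : ℝ)).mul_const y).const_add x
    have hD : ∀ a : Phase, fderiv ℝ (chart R₁ R₂) z a =
        (polarDeriv R₁ ((z.1 0 + z.2 1) / √2) ((z.2 0 - z.1 1) / √2)
            ((a.1 0 + a.2 1) / √2) ((a.2 0 - a.1 1) / √2),
          flip (polarDeriv R₂ ((z.1 0 - z.2 1) / √2) ((z.2 0 + z.1 1) / √2)
            ((a.1 0 - a.2 1) / √2) ((a.2 0 + a.1 1) / √2))) := by
      intro a
      refine fderiv_apply_eq_of_hasDerivAt
        ((hsmooth.contDiffAt (hopen.mem_nhds hz)).differentiableAt (by simp)) ?_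
      have hq0 := hline (z.1 0) (a.1 0)
      have hq1 := hline (z.1 1) (a.1 1)
      have hp0 := hline (z.2 0) (a.2 0)
      have hp1 := hline (z.2 1) (a.2 1)
      have k1 := hasDerivAt_polar hR₁ (by simpa using hz.1) ((hq0.add hp1).div_const √2)
        ((hp0.sub hq1).div_const √2)
      have k2 := hasDerivAt_flip (hasDerivAt_polar hR₂ (by simpa using hz.2)
        ((hq0.sub hp1).div_const √2) ((hp0.add hq1).div_const √2))
      convert! HasDerivAt.prodMk k1 k2 using 2
      · simp
      · simp
    rw [hD, hD]
    simp only [symplecticForm, chart, flip_areaForm]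
    rw [polar_areaForm hR₁ hz.1, polar_areaForm hR₂ hz.2]
    simp only [standardForm, dotProduct, Fin.sum_univ_two]
    field_simp
    rw [hsq]
    ring

/-- The Hamiltonian in the coordinates `chart`. -/
theorem hamiltonian_chart {R₁ R₂ : ℝ} (hR₁ : 0 < R₁) (hR₂ : 0 < R₂) (w t₀ t₁ t₂ t₃ t₄ : ℝ)
    (z : Phase) :
    hamiltonian w t₀ t₁ t₂ t₃ t₄ (chart R₁ R₂ z) =
      let I₁ := (halfQ z + halfP z + genS z) / 2
      let I₂ := (halfQ z + halfP z - genS z) / 2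
      t₀ * (I₂ / R₂ - I₁ / R₁) ^ 2 + w * (t₁ * (1 - I₁ / R₁) + t₂ * (I₂ / R₂ - 1))
        + t₃ * (√(1 - I₁ / (2 * R₁)) * √(1 - I₂ / (2 * R₂)) * (halfP z - halfQ z) / √(R₁ * R₂))
        + t₄ * ((1 - I₁ / R₁) * (I₂ / R₂ - 1)) := by
  have hsq : √2 ^ 2 = (2 : ℝ) := Real.sq_sqrt zero_le_two
  have hsq0 : √2 ≠ (0 : ℝ) := by positivity
  have h1 : ((z.1 0 + z.2 1) / √2) ^ 2 + ((z.2 0 - z.1 1) / √2) ^ 2 =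
      halfQ z + halfP z + genS z := by
    rw [div_pow, div_pow, hsq]; simp only [halfQ, halfP, genS]; ring
  have h2 : ((z.1 0 - z.2 1) / √2) ^ 2 + ((z.2 0 + z.1 1) / √2) ^ 2 =
      halfQ z + halfP z - genS z := by
    rw [div_pow, div_pow, hsq]; simp only [halfQ, halfP, genS]; ring
  have e1 : (halfQ z + halfP z + genS z) / (4 * R₁) =
      (halfQ z + halfP z + genS z) / 2 / (2 * R₁) := by field_simp; norm_num
  have e2 : (halfQ z + halfP z - genS z) / (4 * R₂) =
      (halfQ z + halfP z - genS z) / 2 / (2 * R₂) := by field_simp; norm_num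
  have h3 : (z.2 0 - z.1 1) * (z.2 0 + z.1 1) - (z.1 0 + z.2 1) * (z.1 0 - z.2 1) =
      2 * (halfP z - halfQ z) := by simp only [halfQ, halfP]; ring
  simp only [hamiltonian, chart, polar, polarFactor, flip, Matrix.cons_val, h1, h2, e1, e2]
  rw [Real.sqrt_mul hR₁.le]
  have hr1 : √R₁ ≠ 0 := by positivity
  have hr2 : √R₂ ≠ 0 := by positivity
  generalize √(1 - (halfQ z + halfP z + genS z) / 2 / (2 * R₁)) = c₁
  generalize √(1 - (halfQ z + halfP z - genS z) / 2 / (2 * R₂)) = c₂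
  -- This is x₁x₂ + y₁y₂. The sign introduced by `flip` in the first product is what turns it into a
  -- multiple of N - M.
  have h4 : (z.1 0 + z.2 1) / √2 * c₁ / √R₁ * -((z.1 0 - z.2 1) / √2 * c₂ / √R₂) +
      (z.2 0 - z.1 1) / √2 * c₁ / √R₁ * ((z.2 0 + z.1 1) / √2 * c₂ / √R₂) =
      c₁ * c₂ * (halfP z - halfQ z) / (√R₁ * √R₂) := by
    field_simp
    rw [hsq]
    linear_combination c₁ * c₂ * h3
  rw [h4]
  field_simp
  ring

/-! ### The normalising transformation -/

/-- The shears whose product has the invariants transform as under the time one flow of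
`v₀ P M + v₁ P N + v₂ P S + P (v₃ M² + v₄ M N + v₅ N² + v₆ M S + v₇ N S + v₈ S²)`, up to order
six. The symmetry of the factors of degree four avoids further terms of degree six. -/
noncomputable def normalizingShears : List ((Fin 9 → ℝ) → Shear) :=
  -- With M_c = M + cP + c²N, one has M_c - M_{-c} = 2cP, M_c² - M_{-c}² = 4cP(M + c²N) and M_c³ -
  -- M_{-c}³ = 6cP(M + c²N)² + 2c³P³. The weights invert these relations: c = ±1, ±2 give PM and PN,
  -- and c = ±3 is needed for the third cubic. Rewriting P³ by P² = 4MN - S² leaves a multiple of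
  -- PS², compensated by the `v 4 / 20` in `w`. The quartic factors form a palindrome, so their
  -- commutators of degree six cancel.
  let a₁ : (Fin 9 → ℝ) → ℝ := fun v => v 0 / 3 - v 1 / 12
  let a₂ : (Fin 9 → ℝ) → ℝ := fun v => (v 1 - v 0) / 24
  let y₁ : (Fin 9 → ℝ) → ℝ := fun v => v 3 / 4 - 13 * v 4 / 480 + v 5 / 144
  let y₂ : (Fin 9 → ℝ) → ℝ := fun v => -v 3 / 20 + v 4 / 60 - v 5 / 180
  let y₃ : (Fin 9 → ℝ) → ℝ := fun v => v 3 / 180 - v 4 / 480 + v 5 / 720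
  let z₁ : (Fin 9 → ℝ) → ℝ := fun v => v 6 / 3 - v 7 / 12
  let z₂ : (Fin 9 → ℝ) → ℝ := fun v => (v 7 - v 6) / 24
  let w : (Fin 9 → ℝ) → ℝ := fun v => v 8 / 2 + v 4 / 20
  [fun v => ⟨1, a₁ v / 2, v 2 / 4, y₁ v, z₁ v, w v⟩,
    fun v => ⟨-1, -a₁ v / 2, -v 2 / 4, -y₁ v, -z₁ v, -w v⟩,
    fun v => ⟨2, a₂ v / 2, 0, y₂ v, z₂ v, 0⟩,
    fun v => ⟨-2, -a₂ v, 0, -y₂ v, -z₂ v, 0⟩,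
    fun v => ⟨2, a₂ v / 2, 0, 0, 0, 0⟩,
    fun v => ⟨-1, -a₁ v / 2, -v 2 / 4, 0, 0, 0⟩,
    fun v => ⟨1, a₁ v / 2, v 2 / 4, 0, 0, 0⟩,
    fun v => ⟨3, 0, 0, y₃ v, 0, 0⟩,
    fun v => ⟨-3, 0, 0, -y₃ v, 0, 0⟩]

theorem smooth_normalizingShears : ∀ d ∈ normalizingShears, Shear.Smooth d := by
  simp only [normalizingShears, List.forall_mem_cons]
  refine ⟨?_, ?_, ?_, ?_, ?_, ?_, ?_, ?_, ?_, by simp⟩ <;>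
    constructor <;> dsimp only <;> fun_prop

/-- The normalising transformation. -/
noncomputable def normalizingMap (v : Fin 9 → ℝ) : Phase → Phase :=
  Shear.prodMap (normalizingShears.map fun d => d v)

theorem contDiff_normalizingMap :
    ContDiff ℝ ∞ (fun y : (Fin 9 → ℝ) × Phase => normalizingMap y.1 y.2) :=
  Shear.contDiff_prodMap _ smooth_normalizingShears

theorem isSymplecticMap_normalizingMap (v : Fin 9 → ℝ) : IsSymplecticMap (normalizingMap v) :=
  Shear.isSymplecticMap_prodMap _

section

variable (v : Fin 9 → ℝ) {m n p s : ℝ}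

/-- A bracket of a function even in P with one odd in P is even, so only P² has to be eliminated;
the multiplier of `h` is the cofactor of that elimination. The same holds for the three companion
formulas. -/
theorem jetState_normalizingShears_m₂ (h : p ^ 2 + s ^ 2 = 4 * m * n) :
    (jetState m n p s (normalizingShears.map fun d => d v)).m₂ =
      2 * v 0 * m ^ 2 + 6 * v 1 * (m * n) + 2 * v 2 * (m * s) - v 1 * s ^ 2 := by
  simp only [normalizingShears, List.map_cons, List.map_nil, jetState, JetState.step]
  linear_combination v 1 * h

theorem jetState_normalizingShears_n₂ (h : p ^ 2 + s ^ 2 = 4 * m * n) :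
    (jetState m n p s (normalizingShears.map fun d => d v)).n₂ =
      -2 * v 1 * n ^ 2 - 6 * v 0 * (m * n) - 2 * v 2 * (n * s) + v 0 * s ^ 2 := by
  simp only [normalizingShears, List.map_cons, List.map_nil, jetState, JetState.step]
  linear_combination -v 0 * h

theorem jetState_normalizingShears_m₃ (h : p ^ 2 + s ^ 2 = 4 * m * n) :
    (jetState m n p s (normalizingShears.map fun d => d v)).m₃ =
      (4 * v 0 ^ 2 + 2 * v 3) * m ^ 3 + 6 * v 4 * (m ^ 2 * n)
        + (12 * v 1 ^ 2 + 10 * v 5) * (m * n ^ 2) + (6 * v 0 * v 2 + 2 * v 6) * (m ^ 2 * s)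
        + (6 * v 1 * v 2 + 6 * v 7) * (m * n * s)
        + (v 0 * v 1 + 2 * v 2 ^ 2 - v 4 + 2 * v 8) * (m * s ^ 2)
        - (3 * v 1 ^ 2 + 2 * v 5) * (n * s ^ 2) - (v 1 * v 2 + v 7) * s ^ 3 := by
  simp only [normalizingShears, List.map_cons, List.map_nil, jetState, JetState.step]
  linear_combination (-(m * v 0 * v 1) + 6 / 5 * m * v 4 + 3 * n * v 1 ^ 2 + 2 * n * v 5
    + s * v 1 * v 2 + s * v 7) * h

theorem jetState_normalizingShears_n₃ (h : p ^ 2 + s ^ 2 = 4 * m * n) :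
    (jetState m n p s (normalizingShears.map fun d => d v)).n₃ =
      (4 * v 1 ^ 2 - 2 * v 5) * n ^ 3 - 6 * v 4 * (m * n ^ 2)
        + (12 * v 0 ^ 2 - 10 * v 3) * (m ^ 2 * n) + (6 * v 1 * v 2 - 2 * v 7) * (n ^ 2 * s)
        + (6 * v 0 * v 2 - 6 * v 6) * (m * n * s)
        + (v 0 * v 1 + 2 * v 2 ^ 2 + v 4 - 2 * v 8) * (n * s ^ 2)
        - (3 * v 0 ^ 2 - 2 * v 3) * (m * s ^ 2) - (v 0 * v 2 - v 6) * s ^ 3 := by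
  simp only [normalizingShears, List.map_cons, List.map_nil, jetState, JetState.step]
  linear_combination (3 * m * v 0 ^ 2 - 2 * m * v 3 - n * v 0 * v 1 - 6 / 5 * n * v 4
    + s * v 0 * v 2 - s * v 6) * h

end

theorem hasJetState_normalizingMap (v : Fin 9 → ℝ) : HasJetState (normalizingMap v) (fun z =>
    jetState (halfQ z) (halfP z) (dotQP z) (genS z) (normalizingShears.map fun d => d v)) := by
  unfold normalizingMap
  exact hasJetState_prodMap _

attribute [irreducible] normalizingMap

/-! ### Jets of the Hamiltonian -/

/-- The Taylor polynomial -u/2 - u²/8 - u³/16 of √(1 - u) - 1, with u replaced by a jet that starts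
in degree two: the remainder O(u⁴) has order eight. -/
theorem HasJet.sqrt_one_sub_sub_one {f f₁ f₂ f₃ : Phase → ℝ} (hf : HasJet f f₁ f₂ f₃) :
    HasJet (fun z => √(1 - f z) - 1) (fun z => -f₁ z / 2) (fun z => -f₂ z / 2 - f₁ z ^ 2 / 8)
      (fun z => -f₃ z / 2 - f₁ z * f₂ z / 4 - f₁ z ^ 3 / 16) := by
  have hpoly := ((hf.const_mul (-1 / 2)).add ((hf.mul hf).const_mul (-1 / 8))).add
    (((hf.mul hf).mul hf).const_mul (-1 / 16))
  have hf4 : VanishesTo 8 (fun z => f z * f z * (f z * f z)) :=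
    (hf.vanishesTo.mul hf.vanishesTo).mul (hf.vanishesTo.mul hf.vanishesTo)
  have hrem : VanishesTo 8
      (fun z => √(1 - f z) - (1 - f z / 2 - f z ^ 2 / 8 - f z ^ 3 / 16)) := by
    refine Asymptotics.IsBigO.trans ?_ hf4
    have hsmall : ∀ᶠ z in 𝓝 (0 : Phase), |f z| ≤ 1 / 2 := by
      have h1 : Filter.Tendsto f (𝓝 0) (𝓝 0) := by
        refine hf.vanishesTo.trans_tendsto ?_
        have : ContinuousAt (fun z : Phase => ‖z‖ ^ 2) 0 := by fun_prop
        simpa [ContinuousAt] using this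
      have h2 := h1.abs
      rw [abs_zero] at h2
      exact h2.eventually (eventually_le_nhds (by norm_num))
    refine Asymptotics.IsBigO.of_bound 1 ?_
    filter_upwards [hsmall] with z hz
    generalize f z = u at hz
    obtain ⟨hu1, hu2⟩ := abs_le.1 hz
    have hc := Real.sqrt_nonneg (1 - u)
    have hc2 : √(1 - u) ^ 2 = 1 - u := Real.sq_sqrt (by linarith)
    generalize √(1 - u) = c at hc hc2
    have hu2' : u ^ 2 ≤ 1 / 4 := by nlinarith
    have hp : 1 / 2 ≤ 1 - u / 2 - u ^ 2 / 8 - u ^ 3 / 16 := by nlinarith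
    -- Multiplying by the conjugate removes the root. As both factors of c + p are under control, c
    -- + p ≥ 1/2, and the difference is at most u⁴.
    have key : (c - (1 - u / 2 - u ^ 2 / 8 - u ^ 3 / 16))
        * (c + (1 - u / 2 - u ^ 2 / 8 - u ^ 3 / 16))
        = -(u ^ 4 * (5 / 64 + u / 64 + u ^ 2 / 256)) := by
      linear_combination hc2
    generalize 1 - u / 2 - u ^ 2 / 8 - u ^ 3 / 16 = p at hp key
    have h4 : 0 ≤ u ^ 4 := by positivity
    have hk : |c - p| * |c + p| ≤ u ^ 4 * (1 / 2) := by
      rw [← abs_mul, key, abs_neg, abs_of_nonneg (by nlinarith)]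
      exact mul_le_mul_of_nonneg_left (by nlinarith) h4
    have hcp : 1 / 2 ≤ |c + p| := by rw [abs_of_nonneg (by linarith)]; linarith
    have h5 : u * u * (u * u) = u ^ 4 := by ring
    rw [Real.norm_eq_abs, Real.norm_eq_abs, h5, abs_of_nonneg h4, one_mul]
    nlinarith [abs_nonneg (c - p)]
  refine ⟨?_, ?_, ?_, ?_⟩
  · convert hpoly.one using 2; ring
  · convert hpoly.two using 2; ring
  · convert hpoly.three using 2; ring
  · convert hrem.add hpoly.error using 2
    ring

/-! ### Solution of the homological equations. -/

/-- The parameters of the normalising transformation, in terms of the parameters of the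
Hamiltonian. -/
noncomputable def normalizingVec (x A B δ s : ℝ) : Fin 9 → ℝ :=
  let k : ℝ := (1 - x) / 2
  let D : ℝ := -(k * s) / 4
  let E : ℝ := -(k * δ) / 4
  -- The entries make the coefficients of N², MN, NS and then of N³, MN², M²N, N²S, MNS, NS² vanish.
  -- Each new unknown appears in its equation with factor -2, -6 or -10, so no division by an
  -- expression in x occurs.
  ![A / 3 + x * (A + D) / 2, (A + D) / 2, (B + E) / 2,
    (7 / 15 - x ^ 2 / 2) * A ^ 2 - x ^ 2 * (A * D) - (3 / 5 + x ^ 2 / 2) * D ^ 2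
      + k * δ ^ 2 * (1 - x - 5 * x ^ 2) / 320,
    -4 / 3 * x * (A + D) ^ 2 - k * δ ^ 2 * (1 + 5 * x) / 192,
    -(A + D) ^ 2 / 2 - k * δ ^ 2 / 64,
    (1 / 3 - 3 / 4 * x) * (A * B) - (2 / 3 + 3 / 4 * x) * (A * E) + (1 / 2 - 3 / 4 * x) * (B * D)
      - k * δ * s * (2 + 5 * x - 3 * x ^ 2) / 128,
    -3 / 4 * (A * B + A * E + B * D) + k * δ * s * (3 * x - 7) / 128,
    (x - 1) / 12 * A ^ 2 - (1 - 2 * x) / 12 * (A * D) - B ^ 2 / 4 - B * E / 2 - E ^ 2 / 3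
      - k * s ^ 2 * (6 - x + x ^ 2) / 384]

/-- The normalised Hamiltonian as a function of `M`, `N` and `S`. -/
noncomputable def reducedHamiltonian (a x A B C δ s S M N : ℝ) : ℝ :=
  a * S + N + x * M + A * (M + N) ^ 2 + B * ((M + N) * S) + C * S ^ 2
    + (1 - x) / 2 * ((N - M) * (√(1 - (s + δ) / 4 * (M + N + S))
      * √(1 - (s - δ) / 4 * (M + N - S)) - 1))

/-- The normal form of the reduced Hamiltonian. -/
noncomputable def reducedCoefficients (a x A B C δ s : ℝ) : Coefficients :=
  let k : ℝ := (1 - x) / 2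
  let D : ℝ := -(k * s) / 4
  let E : ℝ := -(k * δ) / 4
  { a₁ := a
    a₂ := x
    a₃ := A - D + 2 / 3 * A * x + (A + D) * x ^ 2
    a₄ := B - E + (B + E) * x
    a₅ := C + A / 3
    a₆ := 4 / 3 * A * (A - D) + k * δ ^ 2 / 32
      + (152 / 45 * A ^ 2 - 16 / 5 * D ^ 2 + k * δ ^ 2 / 160) * x
      + (4 / 3 * A * (A + D) - k * δ ^ 2 / 160) * x ^ 2
      - k * δ ^ 2 / 32 * x ^ 3
    a₇ := 8 / 3 * A * B + 4 / 3 * A * E - 2 * B * D - 2 * D * E + k * δ * s / 16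
      + (8 / 3 * A * B - 4 / 3 * A * E + 2 * B * D - 2 * D * E) * x
      - k * δ * s / 16 * x ^ 2
    a₈ := 4 / 15 * A ^ 2 + B ^ 2 - D ^ 2 / 5 - E ^ 2
      + (k * δ ^ 2 / 160 + k * s ^ 2 / 32) * (1 - x)
    a₉ := 0 }

/-- The jets of M and N after the normalising map are substituted into the reduced Hamiltonian. For
the chosen parameters all monomials containing N beyond degree two cancel, and the surviving ones
give the coefficients. -/
theorem hasJet_reducedHamiltonian (a x A B C δ s : ℝ) :
    let Ψ := normalizingMap (normalizingVec x A B δ s)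
    let c := reducedCoefficients a x A B C δ s
    HasJet (fun z => reducedHamiltonian a x A B C δ s (genS (Ψ z)) (halfQ (Ψ z)) (halfP (Ψ z)))
      (fun z => c.a₁ * genS z + halfP z + c.a₂ * halfQ z)
      (fun z => c.a₃ * halfQ z ^ 2 + c.a₄ * (halfQ z * genS z) + c.a₅ * genS z ^ 2)
      (fun z => c.a₆ * halfQ z ^ 3 + c.a₇ * (halfQ z ^ 2 * genS z)
        + c.a₈ * (halfQ z * genS z ^ 2) + c.a₉ * genS z ^ 3) := by
  intro Ψ c
  have hσ := hasJetState_normalizingMap (normalizingVec x A B δ s)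
  have hS : HasJet (fun z => genS (Ψ z)) genS (fun _ => 0) (fun _ => 0) := by
    rw [funext hσ.genS]; exact HasJet.of_vanishesTo_two vanishesTo_genS
  have hQ := hσ.halfQ
  have hP := hσ.halfP
  simp only [fun z => jetState_normalizingShears_m₂ (normalizingVec x A B δ s)
    (invariants_relation z), fun z => jetState_normalizingShears_m₃ (normalizingVec x A B δ s)
    (invariants_relation z)] at hQ
  simp only [fun z => jetState_normalizingShears_n₂ (normalizingVec x A B δ s)
    (invariants_relation z), fun z => jetState_normalizingShears_n₃ (normalizingVec x A B δ s)
    (invariants_relation z)] at hP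
  clear hσ
  have hJ := hQ.add hP
  have hu := ((hJ.add hS).const_mul ((s + δ) / 4)).sqrt_one_sub_sub_one
  have hv := ((hJ.add (hS.const_mul (-1))).const_mul ((s - δ) / 4)).sqrt_one_sub_sub_one
  -- If the two roots are 1 + u and 1 + v, their product minus one is u + v + uv.
  have hw := (hu.add hv).add (hu.mul hv)
  have h := (((((hS.const_mul a).add hP).add (hQ.const_mul x)).add
    ((hJ.mul hJ).const_mul A)).add ((hJ.mul hS).const_mul B)).add ((hS.mul hS).const_mul C)
    |>.add (((hP.add (hQ.const_mul (-1))).mul hw).const_mul ((1 - x) / 2))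
  refine h.congr' (fun z => ?_) (fun z => ?_) (fun z => ?_) (fun z => ?_)
  · have e : halfQ (Ψ z) + halfP (Ψ z) - genS (Ψ z)
        = halfQ (Ψ z) + halfP (Ψ z) + -1 * genS (Ψ z) := by ring
    simp only [reducedHamiltonian, e]
    generalize √(1 - (s + δ) / 4 * (halfQ (Ψ z) + halfP (Ψ z) + genS (Ψ z))) = c₁
    generalize √(1 - (s - δ) / 4 * (halfQ (Ψ z) + halfP (Ψ z) + -1 * genS (Ψ z))) = c₂
    ring
  · simp only [c, reducedCoefficients]; ring
  · simp only [c, reducedCoefficients, normalizingVec, Matrix.cons_val]; ring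
  · simp only [c, reducedCoefficients, normalizingVec, Matrix.cons_val]; ring

theorem contDiff_normalizingVec (δ s : ℝ) :
    ContDiff ℝ ∞ (fun y : ℝ × ℝ × ℝ => normalizingVec y.1 y.2.1 y.2.2 δ s) := by
  refine contDiff_pi.2 fun i => ?_
  fin_cases i <;> simp [normalizingVec] <;> fun_prop

attribute [irreducible] normalizingVec

/-! ### The coefficients as functions of `t₄` -/

section Coefficients

variable {R₁ R₂ : ℝ} (w t₀ t₁ t₂ t₃ : ℝ)

theorem coeffN_eq (hR₁ : 0 < R₁) (hR₂ : 0 < R₂) (t : ℝ) : coeffN R₁ R₂ w t₁ t₂ t₃ t =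
    (R₁ + R₂) / (2 * R₁ * R₂) * (t - t₄m₀ (-1) R₁ R₂ w t₁ t₂ t₃) := by
  simp only [coeffN, t₄m₀]
  field_simp
  ring

theorem coeffM_eq (hR₁ : 0 < R₁) (hR₂ : 0 < R₂) (t : ℝ) : coeffM R₁ R₂ w t₁ t₂ t₃ t =
    (R₁ + R₂) / (2 * R₁ * R₂) * (t - t₄m₀ 1 R₁ R₂ w t₁ t₂ t₃) := by
  simp only [coeffM, t₄m₀]
  field_simp
  ring

theorem coeffN_ne_zero_iff (hR₁ : 0 < R₁) (hR₂ : 0 < R₂) (t : ℝ) :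
    coeffN R₁ R₂ w t₁ t₂ t₃ t ≠ 0 ↔ t ≠ t₄m₀ (-1) R₁ R₂ w t₁ t₂ t₃ := by
  rw [coeffN_eq _ _ _ _ hR₁ hR₂, mul_ne_zero_iff, sub_ne_zero]
  exact and_iff_right (by positivity)

/-- The coefficient of the square root term is determined by `a₂`. -/
theorem coeff_sqrt_eq (hR₁ : 0 < R₁) (hR₂ : 0 < R₂) {t : ℝ} (hb : coeffN R₁ R₂ w t₁ t₂ t₃ t ≠ 0) :
    t₃ / (√(R₁ * R₂) * coeffN R₁ R₂ w t₁ t₂ t₃ t) =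
      (1 - coeffM R₁ R₂ w t₁ t₂ t₃ t / coeffN R₁ R₂ w t₁ t₂ t₃ t) / 2 := by
  have hr : √(R₁ * R₂) ≠ 0 := by positivity
  have hr2 : √(R₁ * R₂) ^ 2 = R₁ * R₂ := Real.sq_sqrt (by positivity)
  have h : coeffN R₁ R₂ w t₁ t₂ t₃ t - coeffM R₁ R₂ w t₁ t₂ t₃ t = 2 * t₃ / √(R₁ * R₂) := by
    simp only [coeffN, coeffM]
    generalize √(R₁ * R₂) = r at *
    field_simp
    linear_combination 4 * t₃ * hr2
  generalize coeffN R₁ R₂ w t₁ t₂ t₃ t = b at *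
  generalize coeffM R₁ R₂ w t₁ t₂ t₃ t = c at *
  field_simp at h ⊢
  linarith

end Coefficients

/-- The coefficient of `M` after normalisation. -/
noncomputable def ratioM (R₁ R₂ w t₁ t₂ t₃ t : ℝ) : ℝ :=
  coeffM R₁ R₂ w t₁ t₂ t₃ t / coeffN R₁ R₂ w t₁ t₂ t₃ t

/-- The coefficient of `(M + N)²` after normalisation. -/
noncomputable def coeffA (R₁ R₂ w t₀ t₁ t₂ t₃ t : ℝ) : ℝ :=
  (t₀ * ((R₂ - R₁) / (2 * R₁ * R₂)) ^ 2 - t / (4 * R₁ * R₂)) / coeffN R₁ R₂ w t₁ t₂ t₃ t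

/-- The coefficient of `(M + N) S` after normalisation. -/
noncomputable def coeffB (R₁ R₂ w t₀ t₁ t₂ t₃ t : ℝ) : ℝ :=
  2 * t₀ * ((R₂ - R₁) / (2 * R₁ * R₂)) * ((R₁ + R₂) / (2 * R₁ * R₂)) / coeffN R₁ R₂ w t₁ t₂ t₃ t

/-- The coefficient of `S²` after normalisation. -/
noncomputable def coeffC (R₁ R₂ w t₀ t₁ t₂ t₃ t : ℝ) : ℝ :=
  (t₀ * ((R₁ + R₂) / (2 * R₁ * R₂)) ^ 2 + t / (4 * R₁ * R₂)) / coeffN R₁ R₂ w t₁ t₂ t₃ t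

section NormalForm

variable {R₁ R₂ : ℝ} (w t₀ t₁ t₂ t₃ : ℝ)

theorem coefficients_eq (hR₁ : 0 < R₁) (hR₂ : 0 < R₂) {t : ℝ} (hb : coeffN R₁ R₂ w t₁ t₂ t₃ t ≠ 0) :
    coefficients R₁ R₂ w t₀ t₁ t₂ t₃ t =
      reducedCoefficients (coeffS R₁ R₂ w t₁ t₂ t / coeffN R₁ R₂ w t₁ t₂ t₃ t)
        (ratioM R₁ R₂ w t₁ t₂ t₃ t) (coeffA R₁ R₂ w t₀ t₁ t₂ t₃ t)
        (coeffB R₁ R₂ w t₀ t₁ t₂ t₃ t) (coeffC R₁ R₂ w t₀ t₁ t₂ t₃ t)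
        ((R₂ - R₁) / (2 * R₁ * R₂)) ((R₁ + R₂) / (2 * R₁ * R₂)) := by
  simp only [coefficients, reducedCoefficients, coeff_sqrt_eq w t₁ t₂ t₃ hR₁ hR₂ hb, ratioM,
    coeffA, coeffB, coeffC]

/-- This is an exact identity, not one of jets. It uses b - ã₂ = 2t₃/√(R₁R₂), which expresses the
coefficient of the root term by x alone. -/
theorem hamiltonian_chart_eq_reducedHamiltonian (hR₁ : 0 < R₁) (hR₂ : 0 < R₂) {t : ℝ}
    (hb : coeffN R₁ R₂ w t₁ t₂ t₃ t ≠ 0) (z : Phase) :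
    (hamiltonian w t₀ t₁ t₂ t₃ t (chart R₁ R₂ z) - hamiltonian w t₀ t₁ t₂ t₃ t m₀)
        / coeffN R₁ R₂ w t₁ t₂ t₃ t =
      reducedHamiltonian (coeffS R₁ R₂ w t₁ t₂ t / coeffN R₁ R₂ w t₁ t₂ t₃ t)
        (ratioM R₁ R₂ w t₁ t₂ t₃ t) (coeffA R₁ R₂ w t₀ t₁ t₂ t₃ t)
        (coeffB R₁ R₂ w t₀ t₁ t₂ t₃ t) (coeffC R₁ R₂ w t₀ t₁ t₂ t₃ t)
        ((R₂ - R₁) / (2 * R₁ * R₂)) ((R₁ + R₂) / (2 * R₁ * R₂))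
        (genS z) (halfQ z) (halfP z) := by
  have h0 : hamiltonian w t₀ t₁ t₂ t₃ t m₀ = w * (t₁ - t₂) - t := by
    simp [hamiltonian, m₀]; ring
  have hk := coeff_sqrt_eq w t₁ t₂ t₃ hR₁ hR₂ hb
  rw [hamiltonian_chart hR₁ hR₂, h0]
  generalize genS z = S
  generalize halfQ z = M
  generalize halfP z = N
  have e1 : (M + N + S) / 2 / (2 * R₁) =
      ((R₁ + R₂) / (2 * R₁ * R₂) + (R₂ - R₁) / (2 * R₁ * R₂)) / 4 * (M + N + S) := by
    field_simp; ring
  have e2 : (M + N - S) / 2 / (2 * R₂) =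
      ((R₁ + R₂) / (2 * R₁ * R₂) - (R₂ - R₁) / (2 * R₁ * R₂)) / 4 * (M + N - S) := by
    field_simp; ring
  simp only [reducedHamiltonian, e1, e2, ratioM]
  generalize √(1 - ((R₁ + R₂) / (2 * R₁ * R₂) + (R₂ - R₁) / (2 * R₁ * R₂)) / 4 * (M + N + S)) = c₁
  generalize √(1 - ((R₁ + R₂) / (2 * R₁ * R₂) - (R₂ - R₁) / (2 * R₁ * R₂)) / 4 * (M + N - S)) = c₂
  rw [← hk]
  have hr : √(R₁ * R₂) ≠ 0 := by positivity
  -- The terms linear in M and N: the sum M + N comes from the heights, the difference N - M from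
  -- the root term with its roots set to one.
  have hN : coeffN R₁ R₂ w t₁ t₂ t₃ t * N + coeffM R₁ R₂ w t₁ t₂ t₃ t * M =
      -(w * (R₂ * t₁ - R₁ * t₂) - (R₁ + R₂) * t) / (2 * R₁ * R₂) * (M + N)
        + t₃ / √(R₁ * R₂) * (N - M) := by
    have hr2 : √(R₁ * R₂) ^ 2 = R₁ * R₂ := Real.sq_sqrt (by positivity)
    simp only [coeffN, coeffM]
    generalize √(R₁ * R₂) = r at *
    field_simp
    linear_combination 2 * t₃ * (N - M) * hr2
  simp only [coeffA, coeffB, coeffC, coeffS]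
  generalize coeffN R₁ R₂ w t₁ t₂ t₃ t = b at *
  generalize coeffM R₁ R₂ w t₁ t₂ t₃ t = c at *
  have e3 : N + c / b * M = (b * N + c * M) / b := by field_simp
  rw [add_assoc (_ / b * S) N, e3, hN]
  field_simp
  ring

end NormalForm

/-- The coordinates are the fixed `chart` composed with the normalising map, whose parameters are
smooth in t₄ wherever b ≠ 0, that is, away from one critical value. -/
theorem hasNormalForm_m₀ {R₁ R₂ : ℝ} (hR₁ : 0 < R₁) (hR₂ : 0 < R₂) (w t₀ t₁ t₂ t₃ : ℝ) :
    HasNormalForm R₁ R₂ m₀ (fun t => hamiltonian w t₀ t₁ t₂ t₃ t)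
      {t | t ≠ t₄m₀ (-1) R₁ R₂ w t₁ t₂ t₃} (fun t => coeffN R₁ R₂ w t₁ t₂ t₃ t)
      (fun t z => (coefficients R₁ R₂ w t₀ t₁ t₂ t₃ t).normalForm (genS z) (halfQ z) (halfP z)) := by
  have hN : ContDiff ℝ ∞ (fun t => coeffN R₁ R₂ w t₁ t₂ t₃ t) := by unfold coeffN; fun_prop
  have hM : ContDiff ℝ ∞ (fun t => coeffM R₁ R₂ w t₁ t₂ t₃ t) := by unfold coeffM; fun_prop
  set T : Set ℝ := {t | coeffN R₁ R₂ w t₁ t₂ t₃ t ≠ 0} with hT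
  have hTo : IsOpen T := isOpen_ne_fun hN.continuous continuous_const
  let G : ℝ → Fin 9 → ℝ := fun t => normalizingVec (ratioM R₁ R₂ w t₁ t₂ t₃ t)
    (coeffA R₁ R₂ w t₀ t₁ t₂ t₃ t) (coeffB R₁ R₂ w t₀ t₁ t₂ t₃ t)
    ((R₂ - R₁) / (2 * R₁ * R₂)) ((R₁ + R₂) / (2 * R₁ * R₂))
  have hG : ContDiffOn ℝ ∞ G T := by
    have h1 : ContDiffOn ℝ ∞ (fun t => ratioM R₁ R₂ w t₁ t₂ t₃ t) T :=
      hM.contDiffOn.div hN.contDiffOn fun t ht => ht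
    have h2 : ContDiffOn ℝ ∞ (fun t => coeffA R₁ R₂ w t₀ t₁ t₂ t₃ t) T :=
      (ContDiff.contDiffOn (by fun_prop)).div hN.contDiffOn fun t ht => ht
    have h3 : ContDiffOn ℝ ∞ (fun t => coeffB R₁ R₂ w t₀ t₁ t₂ t₃ t) T :=
      contDiffOn_const.div hN.contDiffOn fun t ht => ht
    exact (contDiff_normalizingVec _ _).comp_contDiffOn (h1.prodMk (h2.prodMk h3))
  have hΨ : ContDiffOn ℝ ∞ (fun y : ℝ × Phase => normalizingMap (G y.1) y.2)
      (T ×ˢ Set.univ) :=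
    contDiff_normalizingMap.comp_contDiffOn
      ((hG.comp contDiff_fst.contDiffOn fun y hy => hy.1).prodMk contDiff_snd.contDiffOn)
  have hchart := isCanonicalCoordinates_chart hR₁ hR₂
  refine ⟨(T ×ˢ Set.univ) ∩ (fun y : ℝ × Phase => normalizingMap (G y.1) y.2) ⁻¹'
    chartDomain R₁ R₂, fun y => chart R₁ R₂ (normalizingMap (G y.1) y.2), ?_, ?_, ?_⟩
  · exact hΨ.continuousOn.isOpen_inter_preimage (hTo.prod isOpen_univ) hchart.isOpen
  · exact hchart.smooth.comp (hΨ.mono Set.inter_subset_left) fun y hy => hy.2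
  · intro t ht
    have hb := (coeffN_ne_zero_iff w t₁ t₂ t₃ hR₁ hR₂ t).2 ht
    refine ⟨?_, hb, ?_⟩
    · have h := hchart.comp (isSymplecticMap_normalizingMap (G t))
      have hV : {z | (t, z) ∈ (T ×ˢ Set.univ) ∩ (fun y : ℝ × Phase =>
          normalizingMap (G y.1) y.2) ⁻¹' chartDomain R₁ R₂} =
          normalizingMap (G t) ⁻¹' chartDomain R₁ R₂ := by
        ext z
        exact ⟨fun h => h.2, fun h => ⟨⟨hb, trivial⟩, h⟩⟩
      rw [hV]
      exact h
    · simp only [hamiltonian_chart_eq_reducedHamiltonian w t₀ t₁ t₂ t₃ hR₁ hR₂ hb,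
        coefficients_eq w t₀ t₁ t₂ t₃ hR₁ hR₂ hb]
      -- The jet error has order eight, one better than required.
      have h := (hasJet_reducedHamiltonian
        (coeffS R₁ R₂ w t₁ t₂ t / coeffN R₁ R₂ w t₁ t₂ t₃ t)
        (ratioM R₁ R₂ w t₁ t₂ t₃ t) (coeffA R₁ R₂ w t₀ t₁ t₂ t₃ t)
        (coeffB R₁ R₂ w t₀ t₁ t₂ t₃ t) (coeffC R₁ R₂ w t₀ t₁ t₂ t₃ t)
        ((R₂ - R₁) / (2 * R₁ * R₂)) ((R₁ + R₂) / (2 * R₁ * R₂))).error.mono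
        (show 7 ≤ 8 by norm_num)
      refine Asymptotics.IsBigO.congr_left h fun z => ?_
      simp only [Coefficients.normalForm, G]
      ring

/-! ### Symmetries -/

/-- Transport of a normal form along a symmetry of the phase spaces. -/
theorem HasNormalForm.transport {R₁ R₂ : ℝ} {m m' : Pair} {H H' : ℝ → Pair → ℝ} {I : Set ℝ}
    {b : ℝ → ℝ} {F F' : ℝ → Phase → ℝ} (h : HasNormalForm R₁ R₂ m H I b F)
    (σ : Pair →L[ℝ] Pair) (hσi : Function.Injective σ)
    (hσs : ∀ v ∈ sphereProduct, σ v ∈ sphereProduct)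
    (hσ : ∀ v a b, symplecticForm R₁ R₂ (σ v) (σ a) (σ b) = symplecticForm R₁ R₂ v a b)
    (hm : σ m = m') (hH : ∀ t v, H' t (σ v) = H t v)
    {Ψ : Phase → Phase} (hΨ : IsSymplecticMap Ψ) (hF : ∀ t z, F' t z = F t (Ψ z)) :
    HasNormalForm R₁ R₂ m' H' I b F' := by
  obtain ⟨U, Φ, hU, hΦ, hI⟩ := h
  have hs : ContDiff ℝ ∞ (fun y : ℝ × Phase => (y.1, Ψ y.2)) :=
    contDiff_fst.prodMk (hΨ.smooth.comp contDiff_snd)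
  refine ⟨(fun y : ℝ × Phase => (y.1, Ψ y.2)) ⁻¹' U, fun y => σ (Φ (y.1, Ψ y.2)),
    hU.preimage hs.continuous,
    σ.contDiff.comp_contDiffOn (hΦ.comp hs.contDiffOn fun _ hy => hy), fun t ht => ?_⟩
  obtain ⟨hc, hb, hO⟩ := hI t ht
  have hc' := hc.comp hΨ
  refine ⟨⟨hc'.isOpen, hc'.zero_mem, ?_, σ.contDiff.comp_contDiffOn hc'.smooth, ?_, ?_, ?_⟩,
    hb, ?_⟩
  · exact (congrArg σ hc'.map_zero).trans hm
  · exact fun z hz z' hz' e => hc'.injective hz hz' (hσi e)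
  · exact fun z hz => hσs _ (hc'.mem_sphereProduct z hz)
  · intro z hz a b
    have hd : DifferentiableAt ℝ (fun z => Φ (t, Ψ z)) z :=
      (hc'.smooth.contDiffAt (hc'.isOpen.mem_nhds hz)).differentiableAt (by simp)
    have he : fderiv ℝ (fun z => σ (Φ (t, Ψ z))) z =
        σ.comp (fderiv ℝ (fun z => Φ (t, Ψ z)) z) :=
      (σ.hasFDerivAt.comp z hd.hasFDerivAt).fderiv
    rw [he]
    simp only [ContinuousLinearMap.comp_apply, hσ]
    exact hc'.symplectic z hz a b
  · have hΨ0 : Filter.Tendsto Ψ (𝓝 0) (𝓝 0) := by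
      have := hΨ.smooth.continuous.tendsto 0
      rwa [hΨ.map_zero] at this
    have h1 := hO.comp_tendsto hΨ0
    -- A map differentiable at its fixed point 0 is at most linear in size there, so orders of
    -- vanishing survive composition.
    have h2 : (fun z => Ψ z) =O[𝓝 0] (fun z : Phase => z) := by
      simpa [hΨ.map_zero] using (hΨ.smooth.differentiable (by simp) 0).isBigO_sub
    have h3 : ((fun z : Phase => ‖z‖ ^ 7) ∘ Ψ) =O[𝓝 0] (fun z : Phase => ‖z‖ ^ 7) :=
      h2.norm_norm.pow 7
    refine Asymptotics.IsBigO.congr_left (h1.trans h3) fun z => ?_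
    simp only [Function.comp_apply, hF, ← hm, hH]

/-- The map which changes the signs of the coordinates of the two vectors according to `e`
and `f`. -/
noncomputable def signMap (e f : Fin 3 → ℝ) : Pair →L[ℝ] Pair :=
  LinearMap.toContinuousLinearMap
    { toFun := fun v => (e * v.1, f * v.2)
      map_add' := fun u v => by simp [mul_add]
      map_smul' := fun c v => by simp }

section SignMap

variable {e f : Fin 3 → ℝ}

theorem signMap_apply (v : Pair) : signMap e f v = (e * v.1, f * v.2) := rfl

theorem signMap_injective (he : e * e = 1) (hf : f * f = 1) : Function.Injective (signMap e f) := by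
  refine Function.LeftInverse.injective (g := signMap e f) fun v => ?_
  simp [signMap_apply, ← mul_assoc, he, hf]

theorem mul_dotProduct_mul (he : e * e = 1) (x : Fin 3 → ℝ) :
    (e * x) ⬝ᵥ (e * x) = x ⬝ᵥ x := by
  have h : ∀ i, e i * e i = 1 := fun i => congrFun he i
  simp only [dotProduct, Pi.mul_apply]
  exact Finset.sum_congr rfl fun i _ => by linear_combination x i * x i * h i

theorem signMap_mem_sphereProduct (he : e * e = 1) (hf : f * f = 1) (v : Pair) (hv : v ∈ sphereProduct) :
    signMap e f v ∈ sphereProduct :=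
  ⟨(mul_dotProduct_mul he _).trans hv.1, (mul_dotProduct_mul hf _).trans hv.2⟩

/-- The triple product is multiplied by the determinant of the diagonal matrix with entries e. -/
theorem mul_areaForm (he : e 0 * e 1 * e 2 = 1) (x a b : Fin 3 → ℝ) :
    (e * x) ⬝ᵥ crossProduct (e * a) (e * b) = x ⬝ᵥ crossProduct a b := by
  simp [dotProduct, Fin.sum_univ_three, crossProduct]
  linear_combination (x 0 * (a 1 * b 2 - a 2 * b 1) + x 1 * (a 2 * b 0 - a 0 * b 2)
    + x 2 * (a 0 * b 1 - a 1 * b 0)) * he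

theorem symplecticForm_signMap (he : e 0 * e 1 * e 2 = 1)
    (hf : f 0 * f 1 * f 2 = 1) (R₁ R₂ : ℝ) (v a b : Pair) :
    symplecticForm R₁ R₂ (signMap e f v) (signMap e f a) (signMap e f b) =
      symplecticForm R₁ R₂ v a b := by
  simp only [symplecticForm, signMap_apply, mul_areaForm he, mul_areaForm hf]

end SignMap

/-- The symplectic map `(q, p) ↦ (-p, q)`. -/
def swap (z : Phase) : Phase := (-z.2, z.1)

theorem isSymplecticMap_swap : IsSymplecticMap swap where
  smooth := by unfold swap; fun_prop
  injective := fun z z' h => by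
    simp only [swap, Prod.mk.injEq, neg_inj] at h
    exact Prod.ext h.2 h.1
  map_zero := by simp [swap]
  symplectic z a b := by
    have h : ∀ v : Phase, fderiv ℝ swap z v = swap v := by
      intro v
      let l : Phase →L[ℝ] Phase :=
        (-ContinuousLinearMap.snd ℝ (Fin 2 → ℝ) (Fin 2 → ℝ)).prod
          (ContinuousLinearMap.fst ℝ (Fin 2 → ℝ) (Fin 2 → ℝ))
      have hl : swap = l := by
        ext z <;> simp [swap, l]
      rw [hl, ContinuousLinearMap.fderiv]
    rw [h, h]
    simp [standardForm, swap, dotProduct, Fin.sum_univ_two]; ring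

theorem genS_swap (z : Phase) : genS (swap z) = genS z := by
  simp [genS, swap]; ring

theorem halfQ_swap (z : Phase) : halfQ (swap z) = halfP z := by
  simp [halfQ, halfP, swap]

theorem halfP_swap (z : Phase) : halfP (swap z) = halfQ z := rfl

/-- The normal form with the roles of `M` and `N` interchanged. -/
theorem hasNormalForm_m₀_swap {R₁ R₂ : ℝ} (hR₁ : 0 < R₁) (hR₂ : 0 < R₂) (w t₀ t₁ t₂ t₃ : ℝ) :
    HasNormalForm R₁ R₂ m₀ (fun t => hamiltonian w t₀ t₁ t₂ t₃ t)
      {t | t ≠ t₄m₀ (-1) R₁ R₂ w t₁ t₂ (-t₃)} (fun t => coeffN R₁ R₂ w t₁ t₂ (-t₃) t)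
      (fun t z =>
        (coefficients R₁ R₂ w t₀ t₁ t₂ (-t₃) t).normalForm (genS z) (halfP z) (halfQ z)) := by
  have he : (![-1, -1, 1] * ![-1, -1, 1] : Fin 3 → ℝ) = 1 := by
    ext i; fin_cases i <;> simp
  have he' : (![-1, -1, 1] : Fin 3 → ℝ) 0 * (![-1, -1, 1] : Fin 3 → ℝ) 1 *
      (![-1, -1, 1] : Fin 3 → ℝ) 2 = 1 := by simp
  -- A half turn of the first sphere about its vertical axis fixes `m₀` and reverses only the t₃
  -- term; `swap` then exchanges M and N and preserves S.
  refine (hasNormalForm_m₀ hR₁ hR₂ w t₀ t₁ t₂ (-t₃)).transport (signMap ![-1, -1, 1] 1)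
    (signMap_injective he (mul_one 1)) (signMap_mem_sphereProduct he (mul_one 1))
    (symplecticForm_signMap he' (by simp) R₁ R₂)
    ?_ ?_ isSymplecticMap_swap ?_
  · refine Prod.ext ?_ ?_ <;> ext i <;> fin_cases i <;> simp [signMap_apply, m₀]
  · intro t v
    simp [hamiltonian, signMap_apply]
    ring
  · intro t z
    simp only [genS_swap, halfQ_swap, halfP_swap]

/-- A normal form at `m₀` gives one at `m₂`, with the sign of `w` reversed. -/
theorem HasNormalForm.m₂_of_m₀ {R₁ R₂ w t₀ t₁ t₂ t₃ : ℝ} {I : Set ℝ} {b : ℝ → ℝ}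
    {F : ℝ → Phase → ℝ}
    (h : HasNormalForm R₁ R₂ m₀ (fun t => hamiltonian (-w) t₀ t₁ t₂ t₃ t) I b F) :
    HasNormalForm R₁ R₂ m₂ (fun t => hamiltonian w t₀ t₁ t₂ t₃ t) I b F := by
  have he : (![1, -1, -1] * ![1, -1, -1] : Fin 3 → ℝ) = 1 := by
    ext i; fin_cases i <;> simp
  have he' : (![1, -1, -1] : Fin 3 → ℝ) 0 * (![1, -1, -1] : Fin 3 → ℝ) 1 *
      (![1, -1, -1] : Fin 3 → ℝ) 2 = 1 := by simp
  -- A half turn of both spheres about the first axis reverses both heights, hence only the sign of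
  -- the w term, and exchanges `m₀` with `m₂`.
  refine h.transport (signMap ![1, -1, -1] ![1, -1, -1])
    (signMap_injective he he) (signMap_mem_sphereProduct he he)
    (symplecticForm_signMap he' he' R₁ R₂)
    ?_ ?_ IsSymplecticMap.id fun t z => rfl
  · refine Prod.ext ?_ ?_ <;> ext i <;> fin_cases i <;> simp [signMap_apply, m₀, m₂]
  · intro t v
    simp [hamiltonian, signMap_apply]
    ring

/-! ### The Hamiltonian Hopf bifurcation -/

/-- A quadratic function which Poisson commutes with `S`. -/
structure IsQuadraticInvariant (g : Phase → ℝ) : Prop where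
  smooth : ContDiff ℝ ∞ g
  homogeneous : ∀ (c : ℝ) (z : Phase), g (c • z) = c ^ 2 * g z
  poisson : ∀ z, poisson genS g z = 0

theorem poisson_self (g : Phase → ℝ) (z : Phase) : poisson g g z = 0 := by
  simp only [poisson]
  exact Finset.sum_eq_zero fun i _ => by ring

theorem poisson_swap (f g : Phase → ℝ) (z : Phase) : poisson f g z = -poisson g f z := by
  simp only [poisson, ← Finset.sum_neg_distrib]
  exact Finset.sum_congr rfl fun i _ => by ring

/-- A function which commutes with `g` and `h` commutes with every function of `g` and `h`. -/
theorem poisson_comp_eq_zero {f g h G : Phase → ℝ} {z : Phase} {a b : ℝ}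
    (hG : fderiv ℝ G z = a • fderiv ℝ g z + b • fderiv ℝ h z)
    (hg : poisson f g z = 0) (hh : poisson f h z = 0) : poisson f G z = 0 := by
  simp only [poisson, Fin.sum_univ_two] at hg hh ⊢
  simp only [hG, add_apply, smul_apply, smul_eq_mul]
  linear_combination a * hg + b * hh

theorem contDiff_genS : ContDiff ℝ ∞ genS := by unfold genS; fun_prop

theorem genS_smul (c : ℝ) (z : Phase) : genS (c • z) = c ^ 2 * genS z := by
  simp [genS]; ring

theorem fderiv_genS_apply (z a : Phase) : fderiv ℝ genS z a =
    a.1 0 * z.2 1 + z.1 0 * a.2 1 - (a.1 1 * z.2 0 + z.1 1 * a.2 0) := by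
  have hline : ∀ x y : ℝ, HasDerivAt (fun τ : ℝ => x + τ * y) y 0 := fun x y => by
    simpa using ((hasDerivAt_id (0 : ℝ)).mul_const y).const_add x
  refine fderiv_apply_eq_of_hasDerivAt (contDiff_genS.differentiable (by simp) z) ?_
  convert! ((hline (z.1 0) (a.1 0)).mul (hline (z.2 1) (a.2 1))).sub
    ((hline (z.1 1) (a.1 1)).mul (hline (z.2 0) (a.2 0))) using 1
  simp

theorem contDiff_halfQ : ContDiff ℝ ∞ halfQ := by unfold halfQ; fun_prop

theorem contDiff_halfP : ContDiff ℝ ∞ halfP := by unfold halfP; fun_prop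

theorem fderiv_halfQ_apply (z a : Phase) :
    fderiv ℝ halfQ z a = z.1 0 * a.1 0 + z.1 1 * a.1 1 := by
  have hline : ∀ x y : ℝ, HasDerivAt (fun τ : ℝ => x + τ * y) y 0 := fun x y => by
    simpa using ((hasDerivAt_id (0 : ℝ)).mul_const y).const_add x
  refine fderiv_apply_eq_of_hasDerivAt (contDiff_halfQ.differentiable (by simp) z) ?_
  convert! (((hline (z.1 0) (a.1 0)).pow 2).add ((hline (z.1 1) (a.1 1)).pow 2)).div_const 2
    using 1
  simp; ring

theorem fderiv_halfP_apply (z a : Phase) :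
    fderiv ℝ halfP z a = z.2 0 * a.2 0 + z.2 1 * a.2 1 := by
  have hline : ∀ x y : ℝ, HasDerivAt (fun τ : ℝ => x + τ * y) y 0 := fun x y => by
    simpa using ((hasDerivAt_id (0 : ℝ)).mul_const y).const_add x
  refine fderiv_apply_eq_of_hasDerivAt (contDiff_halfP.differentiable (by simp) z) ?_
  convert! (((hline (z.2 0) (a.2 0)).pow 2).add ((hline (z.2 1) (a.2 1)).pow 2)).div_const 2
    using 1
  simp; ring

theorem isQuadraticInvariant_halfQ : IsQuadraticInvariant halfQ where
  smooth := contDiff_halfQ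
  homogeneous c z := by simp [halfQ]; ring
  poisson z := by
    simp [Gaudin.poisson, Fin.sum_univ_two, fderiv_genS_apply, fderiv_halfQ_apply]; ring

theorem isQuadraticInvariant_halfP : IsQuadraticInvariant halfP where
  smooth := contDiff_halfP
  homogeneous c z := by simp [halfP]; ring
  poisson z := by
    simp [Gaudin.poisson, Fin.sum_univ_two, fderiv_genS_apply, fderiv_halfP_apply]; ring

theorem t₄m₀_ne {R₁ R₂ : ℝ} (hR₁ : 0 < R₁) (hR₂ : 0 < R₂) (w t₁ t₂ : ℝ) {t₃ : ℝ} (h : t₃ ≠ 0) :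
    t₄m₀ 1 R₁ R₂ w t₁ t₂ t₃ ≠ t₄m₀ (-1) R₁ R₂ w t₁ t₂ t₃ := by
  have hr : √(R₁ * R₂) ≠ 0 := by positivity
  rw [← sub_ne_zero]
  have e : t₄m₀ 1 R₁ R₂ w t₁ t₂ t₃ - t₄m₀ (-1) R₁ R₂ w t₁ t₂ t₃ =
      4 * t₃ * √(R₁ * R₂) / (R₁ + R₂) := by simp only [t₄m₀]; ring
  rw [e]
  positivity

/-- In this form the numerator consists of exactly the two quantities compared in the focus-focus
conditions. -/
theorem coeffS_t₄m₀ {R₁ R₂ : ℝ} (hR₁ : 0 < R₁) (hR₂ : 0 < R₂) (w t₁ t₂ t₃ : ℝ) :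
    coeffS R₁ R₂ w t₁ t₂ (t₄m₀ 1 R₁ R₂ w t₁ t₂ t₃) =
      -(w * (t₁ + t₂) * √(R₁ * R₂) + (R₁ - R₂) * t₃) / (√(R₁ * R₂) * (R₁ + R₂)) := by
  have hr : √(R₁ * R₂) ≠ 0 := by positivity
  have hr2 : √(R₁ * R₂) ^ 2 = R₁ * R₂ := Real.sq_sqrt (by positivity)
  have hs : R₁ + R₂ ≠ 0 := by positivity
  simp only [coeffS, t₄m₀]
  generalize √(R₁ * R₂) = r at *
  field_simp
  linear_combination (-2 * (R₁ - R₂) * t₃) * hr2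

/-- The focus-focus conditions make the frequency at the bifurcation nonzero. -/
theorem FocusFocusConditions.frequency_ne_zero {R₁ R₂ : ℝ} (hR₁ : 0 < R₁) (hR₂ : 0 < R₂)
    {w t₁ t₂ t₃ w' t₃' : ℝ} (h : FocusFocusConditions R₁ R₂ w t₁ t₂ t₃)
    (hw : w' = w ∨ w' = -w) (ht : t₃' = t₃ ∨ t₃' = -t₃) :
    coeffS R₁ R₂ w' t₁ t₂ (t₄m₀ 1 R₁ R₂ w' t₁ t₂ t₃') ≠ 0 := by
  have hr : √(R₁ * R₂) ≠ 0 := by positivity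
  rw [coeffS_t₄m₀ hR₁ hR₂]
  refine div_ne_zero (neg_ne_zero.2 ?_) (by positivity)
  obtain ⟨-, ⟨h1, h2, h3⟩ | ⟨-, h4⟩⟩ := h
  · subst h1
    rw [sub_self, zero_mul, add_zero]
    refine mul_ne_zero (mul_ne_zero ?_ h3) hr
    rcases hw with rfl | rfl
    · exact h2
    · exact neg_ne_zero.2 h2
  -- Strict domination of one summand by the other rules out cancellation for all four choices of
  -- signs of w and t₃.
  · obtain ⟨h5, h6⟩ := abs_lt.1 h4
    rcases hw with rfl | rfl <;> rcases ht with rfl | rfl <;> intro h0 <;> linarith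

section Bifurcation

variable {R₁ R₂ : ℝ} (w t₀ t₁ t₂ t₃ : ℝ)

theorem a₂_t₄m₀ (hR₁ : 0 < R₁) (hR₂ : 0 < R₂) :
    (coefficients R₁ R₂ w t₀ t₁ t₂ t₃ (t₄m₀ 1 R₁ R₂ w t₁ t₂ t₃)).a₂ = 0 := by
  simp only [coefficients, coeffM_eq w t₁ t₂ t₃ hR₁ hR₂]
  simp

theorem deriv_a₂_ne_zero (hR₁ : 0 < R₁) (hR₂ : 0 < R₂) (h : t₃ ≠ 0) :
    deriv (fun t => (coefficients R₁ R₂ w t₀ t₁ t₂ t₃ t).a₂) (t₄m₀ 1 R₁ R₂ w t₁ t₂ t₃) ≠ 0 := by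
  simp only [coefficients, coeffM_eq w t₁ t₂ t₃ hR₁ hR₂, coeffN_eq w t₁ t₂ t₃ hR₁ hR₂]
  have hne := sub_ne_zero.2 (t₄m₀_ne hR₁ hR₂ w t₁ t₂ h)
  have hK : (R₁ + R₂) / (2 * R₁ * R₂) ≠ 0 := by positivity
  generalize t₄m₀ 1 R₁ R₂ w t₁ t₂ t₃ = tc at *
  generalize t₄m₀ (-1) R₁ R₂ w t₁ t₂ t₃ = tm at *
  generalize (R₁ + R₂) / (2 * R₁ * R₂) = K at *
  have hd : ∀ u : ℝ, HasDerivAt (fun t => K * (t - u)) K tc := fun u => by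
    simpa using ((hasDerivAt_id tc).sub_const u).const_mul K
  -- a₂ is a quotient of two affine functions of slope K; its numerator vanishes at `tc`, so only
  -- the term with the derivative of the numerator survives.
  rw [((hd tc).fun_div (hd tm) (mul_ne_zero hK hne)).deriv]
  have hne' : K * (tc - tm) ≠ 0 := mul_ne_zero hK hne
  simp only [sub_self, mul_zero, zero_mul, sub_zero]
  exact div_ne_zero (mul_ne_zero hK hne') (pow_ne_zero 2 hne')

/-- The higher terms are polynomials in M and S, which commute with each other, so by the chain rule
they commute with both. The detuning ν₂ is -a₂, σ is 1, and ρ is the value of a₁ at the critical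
parameter. -/
theorem isHamiltonianHopfNormalForm (hR₁ : 0 < R₁) (hR₂ : 0 < R₂) (h : t₃ ≠ 0)
    (hS : coeffS R₁ R₂ w t₁ t₂ (t₄m₀ 1 R₁ R₂ w t₁ t₂ t₃) ≠ 0) {gM gN : Phase → ℝ}
    (hM : IsQuadraticInvariant gM) :
    IsHamiltonianHopfNormalForm gM gN
      (fun t z => (coefficients R₁ R₂ w t₀ t₁ t₂ t₃ t).normalForm (genS z) (gM z) (gN z))
      (t₄m₀ 1 R₁ R₂ w t₁ t₂ t₃) := by
  have ha₂ := a₂_t₄m₀ (R₁ := R₁) (R₂ := R₂) w t₀ t₁ t₂ t₃ hR₁ hR₂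
  have hda₂ := deriv_a₂_ne_zero (R₁ := R₁) (R₂ := R₂) w t₀ t₁ t₂ t₃ hR₁ hR₂ h
  have hne := t₄m₀_ne hR₁ hR₂ w t₁ t₂ h
  have hnz := coeffN_ne_zero_iff (R₁ := R₁) (R₂ := R₂) w t₁ t₂ t₃ hR₁ hR₂
  have hcN : ContDiff ℝ ∞ (fun t => coeffN R₁ R₂ w t₁ t₂ t₃ t) := by unfold coeffN; fun_prop
  have hcM : ContDiff ℝ ∞ (fun t => coeffM R₁ R₂ w t₁ t₂ t₃ t) := by unfold coeffM; fun_prop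
  have hcS : ContDiff ℝ ∞ (fun t => coeffS R₁ R₂ w t₁ t₂ t) := by unfold coeffS; fun_prop
  set a := coefficients R₁ R₂ w t₀ t₁ t₂ t₃ with ha
  generalize t₄m₀ 1 R₁ R₂ w t₁ t₂ t₃ = tc at *
  generalize t₄m₀ (-1) R₁ R₂ w t₁ t₂ t₃ = tm at *
  -- The interval avoids the zero of b, so a₁ and a₂ are smooth on it.
  obtain ⟨l, r, htc, hlr⟩ : ∃ l r, tc ∈ Set.Ioo l r ∧ Set.Ioo l r ⊆ {t | t ≠ tm} :=
    mem_nhds_iff_exists_Ioo_subset.1 (isOpen_ne.mem_nhds hne)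
  have hN0 : ∀ t ∈ Set.Ioo l r, coeffN R₁ R₂ w t₁ t₂ t₃ t ≠ 0 := fun t ht => (hnz t).2 (hlr ht)
  have h1 : ContDiffOn ℝ ∞ (fun t => (a t).a₁) (Set.Ioo l r) :=
    hcS.contDiffOn.div hcN.contDiffOn hN0
  have h2 : ContDiffOn ℝ ∞ (fun t => (a t).a₂) (Set.Ioo l r) :=
    hcM.contDiffOn.div hcN.contDiffOn hN0
  have hgS := contDiff_genS
  have hgM := hM.smooth
  have hdS : ∀ z, HasFDerivAt genS (fderiv ℝ genS z) z := fun z =>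
    (hgS.differentiable (by simp) z).hasFDerivAt
  have hdM : ∀ z, HasFDerivAt gM (fderiv ℝ gM z) z := fun z =>
    (hgM.differentiable (by simp) z).hasFDerivAt
  have hMS : ∀ z, poisson gM genS z = 0 := fun z => by rw [poisson_swap, hM.poisson, neg_zero]
  have hder : ∀ (Q : ℝ → ℝ → ℝ) (z : Phase) (p q : ℝ),
      HasFDerivAt (fun y : Phase => Q (gM y) (genS y))
        (p • fderiv ℝ gM z + q • fderiv ℝ genS z) z →
      poisson genS (fun y => Q (gM y) (genS y)) z = 0 ∧
        poisson gM (fun y => Q (gM y) (genS y)) z = 0 := fun Q z p q hQ =>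
    ⟨poisson_comp_eq_zero hQ.fderiv (hM.poisson z) (poisson_self _ z),
      poisson_comp_eq_zero hQ.fderiv (poisson_self _ z) (hMS z)⟩
  refine ⟨l, r, (a tc).a₁, 1, fun t => (a t).a₁ - (a tc).a₁, fun t => -(a t).a₂,
    fun t z => (a t).a₃ * gM z ^ 2 + (a t).a₄ * (gM z * genS z) + (a t).a₅ * genS z ^ 2,
    fun t z => (a t).a₆ * gM z ^ 3 + (a t).a₇ * (gM z ^ 2 * genS z)
      + (a t).a₈ * (gM z * genS z ^ 2) + (a t).a₉ * genS z ^ 3,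
    htc, div_ne_zero hS (hN0 tc htc), Or.inl rfl, h1.sub contDiffOn_const, h2.neg,
    sub_self _, neg_eq_zero.2 ha₂, ?_, ?_, ?_⟩
  · rw [deriv.fun_neg]
    exact neg_ne_zero.2 hda₂
  · intro t _
    refine ⟨by fun_prop, fun c z => ?_, by fun_prop, fun c z => ?_, fun z => ?_⟩
    · dsimp only; rw [hM.homogeneous, genS_smul]; ring
    · dsimp only; rw [hM.homogeneous, genS_smul]; ring
    · simp only [Coefficients.normalForm]; ring
  · intro z
    have e4 := hder (fun m s => (a tc).a₃ * m ^ 2 + (a tc).a₄ * (m * s) + (a tc).a₅ * s ^ 2) z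
      ((a tc).a₃ * (2 * gM z) + (a tc).a₄ * genS z) ((a tc).a₄ * gM z + (a tc).a₅ * (2 * genS z))
      (by
        convert! ((((hdM z).pow 2).const_mul (a tc).a₃).add
          (((hdM z).mul (hdS z)).const_mul (a tc).a₄)).add
          (((hdS z).pow 2).const_mul (a tc).a₅) using 1
        ext v <;> simp <;> ring)
    have e6 := hder (fun m s => (a tc).a₆ * m ^ 3 + (a tc).a₇ * (m ^ 2 * s)
        + (a tc).a₈ * (m * s ^ 2) + (a tc).a₉ * s ^ 3) z
      ((a tc).a₆ * (3 * gM z ^ 2) + (a tc).a₇ * (2 * gM z * genS z) + (a tc).a₈ * genS z ^ 2)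
      ((a tc).a₇ * gM z ^ 2 + (a tc).a₈ * (gM z * (2 * genS z)) + (a tc).a₉ * (3 * genS z ^ 2))
      (by
        convert! (((((hdM z).pow 3).const_mul (a tc).a₆).add
          ((((hdM z).pow 2).mul (hdS z)).const_mul (a tc).a₇)).add
          (((hdM z).mul ((hdS z).pow 2)).const_mul (a tc).a₈)).add
          (((hdS z).pow 3).const_mul (a tc).a₉) using 1
        ext v <;> simp <;> ring)
    exact ⟨e4.1, e4.2, e6.1, e6.2⟩

end Bifurcation

/-! ### Symmetries of the critical values, and the four cases. -/

theorem t₄m₀_neg_one (R₁ R₂ w t₁ t₂ t₃ : ℝ) :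
    t₄m₀ (-1) R₁ R₂ w t₁ t₂ t₃ = t₄m₀ 1 R₁ R₂ w t₁ t₂ (-t₃) := by
  simp only [t₄m₀]; ring

theorem t₄m₀_one (R₁ R₂ w t₁ t₂ t₃ : ℝ) :
    t₄m₀ 1 R₁ R₂ w t₁ t₂ t₃ = t₄m₀ (-1) R₁ R₂ w t₁ t₂ (-t₃) := by
  simp only [t₄m₀]; ring

theorem t₄m₂_eq (ε R₁ R₂ w t₁ t₂ t₃ : ℝ) :
    t₄m₂ ε R₁ R₂ w t₁ t₂ t₃ = t₄m₀ ε R₁ R₂ (-w) t₁ t₂ t₃ := by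
  simp only [t₄m₂, t₄m₀]; ring

end Gaudin

/-- The normal forms of the Gaudin Hamiltonian at `m₀` and `m₂`, up to sixth order in `(q, p)`,
describing the Hamiltonian Hopf bifurcations at the four bifurcation values. -/
theorem theorem4p2 (R₁ R₂ w t₀ t₁ t₂ t₃ : ℝ) (hR₁ : 0 < R₁) (hR₂ : 0 < R₂)
    (hff : Gaudin.FocusFocusConditions R₁ R₂ w t₁ t₂ t₃) :
    -- the point `m₀` and the value `t_{4,m₀}^+`, with `M = |q|² / 2`, `N = |p|² / 2`
    (let a : ℝ → Gaudin.Coefficients := fun t₄ => Gaudin.coefficients R₁ R₂ w t₀ t₁ t₂ t₃ t₄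
     let F : ℝ → Gaudin.Phase → ℝ := fun t₄ z =>
       (a t₄).normalForm (Gaudin.genS z) (Gaudin.halfQ z) (Gaudin.halfP z)
     let tc : ℝ := Gaudin.t₄m₀ 1 R₁ R₂ w t₁ t₂ t₃
     Gaudin.HasNormalForm R₁ R₂ Gaudin.m₀
         (fun t₄ => Gaudin.hamiltonian w t₀ t₁ t₂ t₃ t₄)
         {t₄ | t₄ ≠ Gaudin.t₄m₀ (-1) R₁ R₂ w t₁ t₂ t₃}
         (fun t₄ => Gaudin.coeffN R₁ R₂ w t₁ t₂ t₃ t₄) F ∧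
       tc ≠ Gaudin.t₄m₀ (-1) R₁ R₂ w t₁ t₂ t₃ ∧
       (a tc).a₂ = 0 ∧ deriv (fun t₄ => (a t₄).a₂) tc ≠ 0 ∧
       Gaudin.IsHamiltonianHopfNormalForm Gaudin.halfQ Gaudin.halfP F tc) ∧
    -- the point `m₀` and the value `t_{4,m₀}^-`, with `M = |p|² / 2`, `N = |q|² / 2`
    (let a : ℝ → Gaudin.Coefficients := fun t₄ => Gaudin.coefficients R₁ R₂ w t₀ t₁ t₂ (-t₃) t₄
     let F : ℝ → Gaudin.Phase → ℝ := fun t₄ z =>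
       (a t₄).normalForm (Gaudin.genS z) (Gaudin.halfP z) (Gaudin.halfQ z)
     let tc : ℝ := Gaudin.t₄m₀ (-1) R₁ R₂ w t₁ t₂ t₃
     Gaudin.HasNormalForm R₁ R₂ Gaudin.m₀
         (fun t₄ => Gaudin.hamiltonian w t₀ t₁ t₂ t₃ t₄)
         {t₄ | t₄ ≠ Gaudin.t₄m₀ 1 R₁ R₂ w t₁ t₂ t₃}
         (fun t₄ => Gaudin.coeffN R₁ R₂ w t₁ t₂ (-t₃) t₄) F ∧
       tc ≠ Gaudin.t₄m₀ 1 R₁ R₂ w t₁ t₂ t₃ ∧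
       (a tc).a₂ = 0 ∧ deriv (fun t₄ => (a t₄).a₂) tc ≠ 0 ∧
       Gaudin.IsHamiltonianHopfNormalForm Gaudin.halfP Gaudin.halfQ F tc) ∧
    -- the point `m₂` and the value `t_{4,m₂}^+`, with `M = |q|² / 2`, `N = |p|² / 2`
    (let a : ℝ → Gaudin.Coefficients := fun t₄ => Gaudin.coefficients R₁ R₂ (-w) t₀ t₁ t₂ t₃ t₄
     let F : ℝ → Gaudin.Phase → ℝ := fun t₄ z =>
       (a t₄).normalForm (Gaudin.genS z) (Gaudin.halfQ z) (Gaudin.halfP z)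
     let tc : ℝ := Gaudin.t₄m₂ 1 R₁ R₂ w t₁ t₂ t₃
     Gaudin.HasNormalForm R₁ R₂ Gaudin.m₂
         (fun t₄ => Gaudin.hamiltonian w t₀ t₁ t₂ t₃ t₄)
         {t₄ | t₄ ≠ Gaudin.t₄m₂ (-1) R₁ R₂ w t₁ t₂ t₃}
         (fun t₄ => Gaudin.coeffN R₁ R₂ (-w) t₁ t₂ t₃ t₄) F ∧
       tc ≠ Gaudin.t₄m₂ (-1) R₁ R₂ w t₁ t₂ t₃ ∧
       (a tc).a₂ = 0 ∧ deriv (fun t₄ => (a t₄).a₂) tc ≠ 0 ∧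
       Gaudin.IsHamiltonianHopfNormalForm Gaudin.halfQ Gaudin.halfP F tc) ∧
    -- the point `m₂` and the value `t_{4,m₂}^-`, with `M = |p|² / 2`, `N = |q|² / 2`
    (let a : ℝ → Gaudin.Coefficients := fun t₄ => Gaudin.coefficients R₁ R₂ (-w) t₀ t₁ t₂ (-t₃) t₄
     let F : ℝ → Gaudin.Phase → ℝ := fun t₄ z =>
       (a t₄).normalForm (Gaudin.genS z) (Gaudin.halfP z) (Gaudin.halfQ z)
     let tc : ℝ := Gaudin.t₄m₂ (-1) R₁ R₂ w t₁ t₂ t₃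
     Gaudin.HasNormalForm R₁ R₂ Gaudin.m₂
         (fun t₄ => Gaudin.hamiltonian w t₀ t₁ t₂ t₃ t₄)
         {t₄ | t₄ ≠ Gaudin.t₄m₂ 1 R₁ R₂ w t₁ t₂ t₃}
         (fun t₄ => Gaudin.coeffN R₁ R₂ (-w) t₁ t₂ (-t₃) t₄) F ∧
       tc ≠ Gaudin.t₄m₂ 1 R₁ R₂ w t₁ t₂ t₃ ∧
       (a tc).a₂ = 0 ∧ deriv (fun t₄ => (a t₄).a₂) tc ≠ 0 ∧
       Gaudin.IsHamiltonianHopfNormalForm Gaudin.halfP Gaudin.halfQ F tc) := by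
  have h3 : t₃ ≠ 0 := hff.1
  have h3' : -t₃ ≠ 0 := neg_ne_zero.2 h3
  have hQ := Gaudin.isQuadraticInvariant_halfQ
  have hP := Gaudin.isQuadraticInvariant_halfP
  simp only [Gaudin.t₄m₂_eq]
  refine ⟨⟨Gaudin.hasNormalForm_m₀ hR₁ hR₂ w t₀ t₁ t₂ t₃, Gaudin.t₄m₀_ne hR₁ hR₂ w t₁ t₂ h3,
      Gaudin.a₂_t₄m₀ w t₀ t₁ t₂ t₃ hR₁ hR₂, Gaudin.deriv_a₂_ne_zero w t₀ t₁ t₂ t₃ hR₁ hR₂ h3,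
      Gaudin.isHamiltonianHopfNormalForm w t₀ t₁ t₂ t₃ hR₁ hR₂ h3
        (hff.frequency_ne_zero hR₁ hR₂ (.inl rfl) (.inl rfl)) hQ⟩, ?_,
    ⟨(Gaudin.hasNormalForm_m₀ hR₁ hR₂ (-w) t₀ t₁ t₂ t₃).m₂_of_m₀,
      Gaudin.t₄m₀_ne hR₁ hR₂ (-w) t₁ t₂ h3,
      Gaudin.a₂_t₄m₀ (-w) t₀ t₁ t₂ t₃ hR₁ hR₂, Gaudin.deriv_a₂_ne_zero (-w) t₀ t₁ t₂ t₃ hR₁ hR₂ h3,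
      Gaudin.isHamiltonianHopfNormalForm (-w) t₀ t₁ t₂ t₃ hR₁ hR₂ h3
        (hff.frequency_ne_zero hR₁ hR₂ (.inr rfl) (.inl rfl)) hQ⟩, ?_⟩
  -- Reversing t₃ exchanges the two critical values, so the minus case for t₃ is the plus case for
  -- -t₃ in the swapped coordinates.
  · rw [Gaudin.t₄m₀_neg_one, Gaudin.t₄m₀_one R₁ R₂ w t₁ t₂ t₃]
    exact ⟨Gaudin.hasNormalForm_m₀_swap hR₁ hR₂ w t₀ t₁ t₂ t₃,
      Gaudin.t₄m₀_ne hR₁ hR₂ w t₁ t₂ h3', Gaudin.a₂_t₄m₀ w t₀ t₁ t₂ (-t₃) hR₁ hR₂,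
      Gaudin.deriv_a₂_ne_zero w t₀ t₁ t₂ (-t₃) hR₁ hR₂ h3',
      Gaudin.isHamiltonianHopfNormalForm w t₀ t₁ t₂ (-t₃) hR₁ hR₂ h3'
        (hff.frequency_ne_zero hR₁ hR₂ (.inl rfl) (.inr rfl)) hP⟩
  · rw [Gaudin.t₄m₀_neg_one, Gaudin.t₄m₀_one R₁ R₂ (-w) t₁ t₂ t₃]
    exact ⟨(Gaudin.hasNormalForm_m₀_swap hR₁ hR₂ (-w) t₀ t₁ t₂ t₃).m₂_of_m₀,
      Gaudin.t₄m₀_ne hR₁ hR₂ (-w) t₁ t₂ h3', Gaudin.a₂_t₄m₀ (-w) t₀ t₁ t₂ (-t₃) hR₁ hR₂,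
      Gaudin.deriv_a₂_ne_zero (-w) t₀ t₁ t₂ (-t₃) hR₁ hR₂ h3',
      Gaudin.isHamiltonianHopfNormalForm (-w) t₀ t₁ t₂ (-t₃) hR₁ hR₂ h3'
        (hff.frequency_ne_zero hR₁ hR₂ (.inr rfl) (.inr rfl)) hP⟩
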